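/- **Setting.** A relational database $\mathcal B=(\mathcal D_1,\mathcal D_2,B)$ consists of two tables with $n_1$ and $n_2$ records, whose features take values in finite sets, and a bi-adjacency matrix $B\in\{0,1\}^{n_1\times n_2}$ of relationships. Two databases are adjacent if one arises from the other by choosing a table, modifying the values of a single row of it and changing the relationships of this row. Fix $d_{\max}$ and $m\ge 1$; the private databases are those with exactly $m$ relationships in which each record has at most $d_{\max}$ relationships. A randomized mechanism $\mathcal M$ is $(\epsilon,\delta)$-DP if $\mathbb P(\mathcal M(\mathcal B)\in O)\le e^{\epsilon}\,\mathbb P(\mathcal M(\mathcal B')\in O)+\delta$ for all adjacent private databases $\mathcal B,\mathcal B'$ and all sets $O$ of outputs. For $S_1$, $S_2$ sets of features of the two tables with $|S_1|+|S_2|=k$, $0<|S_1|<k$ (a $k$-way cross-table workload $w$), $P_w(\mathcal B)$ is the empirical distribution of these features over the related pairs of records, and the queries of $w$ are its entries. **Mechanism.** Independently generate synthetic tables $\mathcal D_1^{\rm syn}$, $\mathcal D_2^{\rm syn}$ by an $(\epsilon_1,\delta_1)$-DP and an $(\epsilon_2,\delta_2)$-DP mechanism ($\epsilon_i,\delta_i\ge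 0$). Then build the relationships with a budget $\rho_{\rm rel}>0$ as follows. Let $\alpha\in[0,1)$ and $\epsilon_0=\sqrt{2\rho_{\rm rel}/(KT)}$; start with no selected workloads and with an initial $B^{\rm syn}\in\{0,1\}^{n_1^{\rm syn}\times n_2^{\rm syn}}$ chosen (possibly at random) from the synthetic tables. In each of $T$ iterations: 1. From a random subset of the not yet selected workloads (drawn independently of the private data), select $K$ workloads one after the other without replacement (all of the subset if it has fewer than $K$ elements), each with probability proportional to $\exp\bigl(\sqrt\alpha\,\epsilon_0\frac{m}{d_{\max}}\cdot\tfrac12\|P_w(\mathcal B)-P_w(\mathcal B^{\rm syn})\|_1\bigr)$, where $\mathcal B^{\rm syn}=(\mathcal D_1^{\rm syn},\mathcal D_2^{\rm syn},B^{\rm syn})$. 2. Append the queries of the selected workloads to $\hat Q$ (rows: vectorized indicators of the pairs of synthetic records that satisfy the query), and append to $\hat a$ their values on $\mathcal B$ with independent noise $\frac{\sqrt2\,d_{\max}}{m\sqrt{1-\alpha}\,\epsilon_0}\,\mathcal N(0,1)$. 3. Compute a minimizer $\tilde b$ of $\|\frac1{m^{\rm syn}}\hat Q b-\hat a\|_2^2$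 over $b\in[0,1]^{n_1^{\rm syn}n_2^{\rm syn}}$, $\mathbf 1^Tb=m^{\rm syn}$. 4. Replace $B^{\rm syn}$ by a sample from $\tilde b$ by the recursive unbiased sampling: to sample $q$ indices from a vector $x\in[0,1]^N$ with $\mathbf 1^Tx=q$, return $\emptyset$ if $q=0$, draw one index from the distribution $x$ if $q=1$, return all indices if $q=N$; otherwise merge the indices greedily into $L$ groups of consecutive indices with sums at most $1$, sample recursively $L-q$ groups to exclude, with the vector of one minus the group sums, and draw one index from each other group with probability proportional to $x$. The output is $(\mathcal D_1^{\rm syn},\mathcal D_2^{\rm syn},B^{\rm syn})$. **Theorem.** (i) Let $\epsilon_{\rm rel}>0$, $0<\delta_{\rm rel}\le 1$ and $\rho_{\rm rel}=\bigl(\sqrt{\log(1/\delta_{\rm rel})+\epsilon_{\rm rel}}-\sqrt{\log(1/\delta_{\rm rel})}\bigr)^2$. Then the resulting synthetic relational database is $(\epsilon_1+\epsilon_2+\epsilon_{\rm rel},\ \delta_1+\delta_2+\delta_{\rm rel})$-DP. (ii) For every $\rho_{\rm rel}>0$ and $0<\delta_{\rm rel}\le1$, it is $(\epsilon_1+\epsilon_2+\epsilon_{\rm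 rel},\ \delta_1+\delta_2+\delta_{\rm rel})$-DP with $\epsilon_{\rm rel}=\rho_{\rm rel}+2\sqrt{\rho_{\rm rel}\log(1/\delta_{\rm rel})}$, even if steps 3 and 4 are replaced by any randomized update of $B^{\rm syn}$ that uses only the synthetic tables, the current $B^{\rm syn}$, the iteration number, the set of workloads selected so far and $\hat a$ (for example approximate optimization by projected gradient descent, or random slicing). -/

import Mathlib

open MeasureTheory ProbabilityTheory
open scoped ENNReal

noncomputable section

namespace RelSynth

universe u v

/-! ### Relational databases -/

/-- A table with `n` rows; a record has `d` categorical features, the `j`-th with values in `X j`. -/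
def Table {d : ℕ} (X : Fin d → Type u) (n : ℕ) : Type u := Fin n → (j : Fin d) → X j

/-- A bi-adjacency matrix with entries in `{0, 1}`. -/
def Rel (n₁ n₂ : ℕ) : Type := Fin n₁ → Fin n₂ → Bool

/-- A relational database: two tables and the relationships between their records. -/
structure RelDB {d₁ d₂ : ℕ} (X₁ : Fin d₁ → Type u) (X₂ : Fin d₂ → Type v) (n₁ n₂ : ℕ) where
  D₁ : Table X₁ n₁
  D₂ : Table X₂ n₂
  B : Rel n₁ n₂

instance {d : ℕ} (X : Fin d → Type u) (n : ℕ) : MeasurableSpace (Table X n) := ⊤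

instance {d : ℕ} (X : Fin d → Type u) (n : ℕ) : DiscreteMeasurableSpace (Table X n) :=
  ⟨fun _ => trivial⟩

instance {d : ℕ} (X : Fin d → Type u) [∀ j, Fintype (X j)] (n : ℕ) : Finite (Table X n) :=
  inferInstanceAs (Finite (Fin n → (j : Fin d) → X j))

instance (n₁ n₂ : ℕ) : MeasurableSpace (Rel n₁ n₂) := ⊤

instance (n₁ n₂ : ℕ) : DiscreteMeasurableSpace (Rel n₁ n₂) := ⟨fun _ => trivial⟩

instance (n₁ n₂ : ℕ) : Finite (Rel n₁ n₂) := inferInstanceAs (Finite (Fin n₁ → Fin n₂ → Bool))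

instance {d₁ d₂ : ℕ} (X₁ : Fin d₁ → Type u) (X₂ : Fin d₂ → Type v) (n₁ n₂ : ℕ) :
    MeasurableSpace (RelDB X₁ X₂ n₁ n₂) := ⊤

/-- The number of relationships. -/
def Rel.count {n₁ n₂ : ℕ} (B : Rel n₁ n₂) : ℕ := ∑ i, ∑ j, if B i j then 1 else 0

/-- The degree of the `i`-th record of the first table. -/
def Rel.deg₁ {n₁ n₂ : ℕ} (B : Rel n₁ n₂) (i : Fin n₁) : ℕ := ∑ j, if B i j then 1 else 0

/-- The degree of the `j`-th record of the second table. -/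
def Rel.deg₂ {n₁ n₂ : ℕ} (B : Rel n₁ n₂) (j : Fin n₂) : ℕ := ∑ i, if B i j then 1 else 0

section

variable {d₁ d₂ : ℕ} {X₁ : Fin d₁ → Type u} {X₂ : Fin d₂ → Type v} {n₁ n₂ : ℕ}

/-- One database arises from the other by selecting a table, modifying the values of a single row
of this table and changing the relationships of this row. -/
def Adjacent (𝓑 𝓑' : RelDB X₁ X₂ n₁ n₂) : Prop :=
  (∃ i, (∀ i', i' ≠ i → 𝓑.D₁ i' = 𝓑'.D₁ i') ∧ 𝓑.D₂ = 𝓑'.D₂ ∧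
      ∀ i', i' ≠ i → ∀ j, 𝓑.B i' j = 𝓑'.B i' j) ∨
  (∃ j, (∀ j', j' ≠ j → 𝓑.D₂ j' = 𝓑'.D₂ j') ∧ 𝓑.D₁ = 𝓑'.D₁ ∧
      ∀ j', j' ≠ j → ∀ i, 𝓑.B i j' = 𝓑'.B i j')

/-- The databases with exactly `m` relationships in which every record has degree at most
`dmax`. -/
def BoundedDB (X₁ : Fin d₁ → Type u) (X₂ : Fin d₂ → Type v) (n₁ n₂ dmax m : ℕ) :
    Set (RelDB X₁ X₂ n₁ n₂) :=
  {𝓑 | 𝓑.B.count = m ∧ (∀ i, 𝓑.B.deg₁ i ≤ dmax) ∧ ∀ j, 𝓑.B.deg₂ j ≤ dmax}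

/-- `(ε, δ)`-differential privacy of the randomized mechanism `M`, whose inputs are the databases
in `Dom`; `M 𝓑` is the law of the output on input `𝓑`. -/
def IsDP {R : Type*} [MeasurableSpace R] (Dom : Set (RelDB X₁ X₂ n₁ n₂))
    (M : RelDB X₁ X₂ n₁ n₂ → Measure R) (ε δ : ℝ) : Prop :=
  ∀ 𝓑 ∈ Dom, ∀ 𝓑' ∈ Dom, Adjacent 𝓑 𝓑' → ∀ O : Set R, MeasurableSet O →
    M 𝓑 O ≤ ENNReal.ofReal (Real.exp ε) * M 𝓑' O + ENNReal.ofReal δ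

end

/-! ### Cross-table marginal queries -/

/-- A cross-table `k`-way workload: `S₁ ⊆ [d₁]`, `S₂ ⊆ [d₂]` with `|S₁| + |S₂| = k` and
`0 < |S₁| < k`. -/
abbrev Workload (d₁ d₂ k : ℕ) : Type :=
  {w : Finset (Fin d₁) × Finset (Fin d₂) // w.1.card + w.2.card = k ∧ 0 < w.1.card ∧ w.1.card < k}

/-- A cross-table `k`-way marginal query: a workload with a reference value for each of its
features. -/
abbrev Query {d₁ d₂ : ℕ} (X₁ : Fin d₁ → Type u) (X₂ : Fin d₂ → Type v) (k : ℕ) : Type (max u v) :=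
  Σ w : Workload d₁ d₂ k, ((j : w.1.1) → X₁ j) × ((j : w.1.2) → X₂ j)

instance (d₁ d₂ k : ℕ) : MeasurableSpace (Finset (Workload d₁ d₂ k)) := ⊤

instance (d₁ d₂ k : ℕ) : DiscreteMeasurableSpace (Finset (Workload d₁ d₂ k)) := ⟨fun _ => trivial⟩

section

variable {d₁ d₂ : ℕ} {X₁ : Fin d₁ → Type u} {X₂ : Fin d₂ → Type v} {n₁ n₂ k : ℕ}

open Classical in
/-- The entry of the query vector of `q` at the pair formed by the `i`-th record of `D₁` and the
`j`-th record of `D₂`. -/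
def queryVec (D₁ : Table X₁ n₁) (D₂ : Table X₂ n₂) (q : Query X₁ X₂ k) (i : Fin n₁) (j : Fin n₂) :
    ℝ :=
  if (∀ a : q.1.1.1, D₁ i a = q.2.1 a) ∧ (∀ a : q.1.1.2, D₂ j a = q.2.2 a) then 1 else 0

/-- The value of the query `q` on `𝓑`, the average of `q` over the related pairs. For a fixed
workload `w`, the values on the queries of `w` form the empirical marginal distribution
of `𝓑` on `w`. -/
def marginal (𝓑 : RelDB X₁ X₂ n₁ n₂) (q : Query X₁ X₂ k) : ℝ :=
  (∑ i, ∑ j, if 𝓑.B i j then queryVec 𝓑.D₁ 𝓑.D₂ q i j else 0) / 𝓑.B.count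

/-- Total variation distance of the marginal distributions of the original and the synthetic
database on the workload `w`. -/
def score [∀ j, Fintype (X₁ j)] [∀ j, Fintype (X₂ j)] {n₁' n₂' : ℕ}
    (𝓑 : RelDB X₁ X₂ n₁ n₂) (𝓑syn : RelDB X₁ X₂ n₁' n₂') (w : Workload d₁ d₂ k) : ℝ :=
  (1 / 2) * ∑ y : ((j : w.1.1) → X₁ j) × ((j : w.1.2) → X₂ j),
    |marginal 𝓑 (⟨w, y⟩ : Query X₁ X₂ k) - marginal 𝓑syn (⟨w, y⟩ : Query X₁ X₂ k)|

end

/-! ### Drawing from finite sets -/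

/-- Draw an element of `s` with probability proportional to the weights `x`. (If all weights
on `s` vanish, which no run of the algorithm meets, the value is `a₀`.) -/
def draw {β : Type*} [DecidableEq β] (s : Finset β) (x : β → ℝ) (a₀ : β) : PMF β :=
  if h : ∑ i ∈ s, ENNReal.ofReal (x i) = 0 then PMF.pure a₀
  else PMF.ofFinset
    (fun i => if i ∈ s then ENNReal.ofReal (x i) / ∑ i' ∈ s, ENNReal.ofReal (x i') else 0) s
    (by
      rw [Finset.sum_congr rfl (fun i hi => if_pos hi)]
      simp only [div_eq_mul_inv]
      rw [← Finset.sum_mul]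
      exact ENNReal.mul_inv_cancel h (by simp [ENNReal.sum_eq_top]))
    (fun i hi => if_neg hi)

/-- `K` rounds of the exponential mechanism without replacement: in each round a workload is drawn
from the remaining ones in `P` with the probabilities `softmax u`. The result is the set of the
selected workloads (all of `P` if `P` has fewer than `K` elements). -/
def expSelect {β : Type*} [DecidableEq β] (u : β → ℝ) : ℕ → Finset β → PMF (Finset β)
  | 0, _ => PMF.pure ∅
  | K + 1, P =>
    if h : P.Nonempty then
      (draw P (fun w => Real.exp (u w)) h.choose).bind fun w =>
        (expSelect u K (P.erase w)).map (insert w)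
    else PMF.pure ∅

/-! ### Unbiased sampling -/

/-- Greedy merging of consecutive indices: the group that contains the index `i`, and the sum of
the `x l` over the indices `l ≤ i` of this group. A new group is opened when the sum would
exceed `1`. -/
def merge (x : ℕ → ℝ) : ℕ → ℕ × ℝ
  | 0 => (0, x 0)
  | i + 1 =>
    if (merge x i).2 + x (i + 1) > 1 then ((merge x i).1 + 1, x (i + 1))
    else ((merge x i).1, (merge x i).2 + x (i + 1))

/-- The `g`-th group of the indices `0, …, N - 1`. -/
def group (N : ℕ) (x : ℕ → ℝ) (g : ℕ) : Finset ℕ := (Finset.range N).filter fun i => (merge x i).1 = g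

/-- From each of the groups `0, …, L - 1` outside `J`, draw one index, the index `i` with
probability proportional to `x i`. -/
def drawGroups (N : ℕ) (x : ℕ → ℝ) (J : Finset ℕ) : ℕ → PMF (Finset ℕ)
  | 0 => PMF.pure ∅
  | g + 1 =>
    (drawGroups N x J g).bind fun O =>
      if g ∈ J then PMF.pure O else (draw (group N x g) x 0).map fun s => insert s O

/-- The recursive unbiased sampling of `m` of the indices `0, …, N - 1`: merge the indices into `L`
groups, exclude `L - m` groups by a recursive call on the complementary probabilities, and draw one
index from each remaining group. The first argument bounds the depth of the recursion; as the
number of indices to sample decreases in every recursive call, the value `m` is large enough. -/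
def ubs : ℕ → (N m : ℕ) → (ℕ → ℝ) → PMF (Finset ℕ)
  | 0, _, _, _ => PMF.pure ∅
  | f + 1, N, m, x =>
    if m = 0 then PMF.pure ∅
    else if m = 1 then (draw (Finset.range N) x 0).map fun s => {s}
    else if m = N then PMF.pure (Finset.range N)
    else
      (ubs f ((merge x (N - 1)).1 + 1) ((merge x (N - 1)).1 + 1 - m)
          (fun g => 1 - ∑ i ∈ group N x g, x i)).bind fun J =>
        drawGroups N x J ((merge x (N - 1)).1 + 1)

lemma measurable_draw {A β : Type*} [MeasurableSpace A] [DecidableEq β] (s : A → Finset β)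
    (x : A → β → ℝ) (a₀ i : β) (F : Finset β) (hF : ∀ a, s a ⊆ F)
    (hs : ∀ i, MeasurableSet {a | i ∈ s a}) (hx : ∀ i, Measurable fun a => x a i) :
    Measurable fun a => draw (s a) (x a) a₀ i := by
  classical
  have hsum : Measurable fun a => ∑ i ∈ s a, ENNReal.ofReal (x a i) := by
    have : (fun a => ∑ i ∈ s a, ENNReal.ofReal (x a i)) =
        fun a => ∑ i ∈ F, if i ∈ s a then ENNReal.ofReal (x a i) else 0 := by
      funext a
      rw [← Finset.sum_filter, Finset.filter_mem_eq_inter, Finset.inter_eq_right.2 (hF a)]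
    rw [this]
    exact Finset.measurable_sum _ fun i _ =>
      Measurable.ite (hs i) (hx i).ennreal_ofReal measurable_const
  have : (fun a => draw (s a) (x a) a₀ i) = fun a =>
      if ∑ i ∈ s a, ENNReal.ofReal (x a i) = 0 then PMF.pure a₀ i else
        if i ∈ s a then ENNReal.ofReal (x a i) / ∑ i' ∈ s a, ENNReal.ofReal (x a i') else 0 := by
    funext a
    unfold draw
    split_ifs <;> simp_all [PMF.ofFinset_apply]
  rw [this]
  refine Measurable.ite (hsum (measurableSet_singleton 0)) measurable_const ?_
  exact Measurable.ite (hs i) ((hx i).ennreal_ofReal.div hsum) measurable_const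

lemma measurable_bind {A β γ : Type*} [MeasurableSpace A] [Countable β] (p : A → PMF β)
    (q : A → β → PMF γ) (c : γ) (hp : ∀ b, Measurable fun a => p a b)
    (hq : ∀ b, Measurable fun a => q a b c) : Measurable fun a => (p a).bind (q a) c := by
  simp only [PMF.bind_apply]
  exact Measurable.tsum fun b => (hp b).mul (hq b)

lemma measurable_map {A β γ : Type*} [MeasurableSpace A] [Countable β] (p : A → PMF β)
    (f : β → γ) (c : γ) (hp : ∀ b, Measurable fun a => p a b) :
    Measurable fun a => (p a).map f c := by
  simp only [PMF.map]
  exact measurable_bind p _ c hp fun b => measurable_const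

lemma measurable_merge {A : Type*} [MeasurableSpace A] (x : A → ℕ → ℝ)
    (hx : ∀ i, Measurable fun a => x a i) (i : ℕ) : Measurable fun a => merge (x a) i := by
  induction i with
  | zero => exact measurable_const.prodMk (hx 0)
  | succ i ih =>
    refine Measurable.ite (measurableSet_lt measurable_const (ih.snd.add (hx _))) ?_ ?_
    · exact ((measurable_of_countable (fun n : ℕ => n + 1)).comp ih.fst).prodMk (hx _)
    · exact ih.fst.prodMk (ih.snd.add (hx _))

lemma measurableSet_group {A : Type*} [MeasurableSpace A] (N : ℕ) (x : A → ℕ → ℝ)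
    (hx : ∀ i, Measurable fun a => x a i) (g i : ℕ) : MeasurableSet {a | i ∈ group N (x a) g} := by
  have : {a | i ∈ group N (x a) g} = {a | i < N} ∩ {a | (merge (x a) i).1 = g} := by
    ext a; simp [group]
  rw [this]
  exact (MeasurableSet.const _).inter ((measurable_merge x hx i).fst (measurableSet_singleton g))

lemma measurable_drawGroups {A : Type*} [MeasurableSpace A] (N : ℕ) (x : A → ℕ → ℝ)
    (hx : ∀ i, Measurable fun a => x a i) (J : Finset ℕ) (L : ℕ) (O : Finset ℕ) :
    Measurable fun a => drawGroups N (x a) J L O := by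
  induction L generalizing O with
  | zero => exact measurable_const
  | succ g ih =>
    refine measurable_bind _ _ O ih fun O' => ?_
    by_cases hg : g ∈ J
    · simp only [hg, if_true]; exact measurable_const
    · simp only [hg, if_false]
      exact measurable_map _ _ O fun s => measurable_draw _ _ 0 s (Finset.range N)
        (fun a => Finset.filter_subset _ _) (measurableSet_group N x hx g) hx

lemma measurable_ubs {A : Type*} [MeasurableSpace A] (f N m : ℕ) (x : A → ℕ → ℝ)
    (hx : ∀ i, Measurable fun a => x a i) (O : Finset ℕ) :
    Measurable fun a => ubs f N m (x a) O := by
  classical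
  induction f generalizing N m x O with
  | zero => exact measurable_const
  | succ f ih =>
    unfold ubs
    split_ifs
    · exact measurable_const
    · exact measurable_map _ _ O fun s => measurable_draw _ _ 0 s (Finset.range N)
        (fun a => subset_rfl) (fun i => MeasurableSet.const _) hx
    · exact measurable_const
    · have hL : Measurable fun a => (merge (x a) (N - 1)).1 := (measurable_merge x hx _).fst
      have key : ∀ l : ℕ, Measurable fun a =>
          ((ubs f (l + 1) (l + 1 - m) (fun g => 1 - ∑ i ∈ group N (x a) g, x a i)).bind
            fun J => drawGroups N (x a) J (l + 1)) O := by
        intro l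
        refine measurable_bind _ _ O (fun J => ih (l + 1) (l + 1 - m)
          (fun a g => 1 - ∑ i ∈ group N (x a) g, x a i) ?_ J) fun J =>
          measurable_drawGroups N x hx J (l + 1) O
        intro g
        refine measurable_const.sub ?_
        simp only [group, Finset.sum_filter]
        exact Finset.measurable_sum _ fun i _ => Measurable.ite
          ((measurable_merge x hx i).fst (measurableSet_singleton g)) (hx i) measurable_const
      have key' : Measurable fun p : ℕ × A =>
          ((ubs f (p.1 + 1) (p.1 + 1 - m) (fun g => 1 - ∑ i ∈ group N (x p.2) g, x p.2 i)).bind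
            fun J => drawGroups N (x p.2) J (p.1 + 1)) O :=
        measurable_from_prod_countable_right fun l => key l
      exact key'.comp (hL.prodMk measurable_id)

/-- The (row by row) vectorization of a weighted bi-adjacency matrix, continued by `0`. -/
def flatten {n₁ n₂ : ℕ} (b : Fin n₁ → Fin n₂ → ℝ) (l : ℕ) : ℝ :=
  if h : l < n₁ * n₂ then b (finProdFinEquiv.symm ⟨l, h⟩).1 (finProdFinEquiv.symm ⟨l, h⟩).2 else 0

/-- The bi-adjacency matrix whose entries `1` are those listed in `O`. -/
def reshape (n₁ n₂ : ℕ) (O : Finset ℕ) : Rel n₁ n₂ := fun i j =>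
  decide ((finProdFinEquiv (i, j) : ℕ) ∈ O)

/-- Unbiased sampling of a bi-adjacency matrix with `m` relationships from a weighted one. -/
def unbiasedSampling (n₁ n₂ m : ℕ) : Kernel (Fin n₁ → Fin n₂ → ℝ) (Rel n₁ n₂) where
  toFun b := ((ubs m (n₁ * n₂) m (flatten b)).map (reshape n₁ n₂)).toMeasure
  measurable' := by
    refine Measure.measurable_of_measurable_coe _ fun s hs => ?_
    simp only [PMF.toMeasure_apply _ hs]
    refine Measurable.tsum fun B => ?_
    by_cases hB : B ∈ s
    · simp only [Set.indicator_of_mem hB]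
      refine measurable_map _ _ B fun O => measurable_ubs _ _ _ _ (fun l => ?_) O
      unfold flatten
      split_ifs <;> fun_prop
    · simp only [Set.indicator_of_notMem hB]; exact measurable_const

/-! ### The algorithm that builds the relationships -/

section

variable {d₁ d₂ : ℕ} {X₁ : Fin d₁ → Type u} {X₂ : Fin d₂ → Type v} {k n₁ n₂ s₁ s₂ : ℕ}

/-- The state of the algorithm: the current relationships `Bsyn`, the set of workloads selected so
far (their queries form `Q̂`) and the noisy answers `â` to these queries (`0` for the other ones). -/
abbrev State {d₁ d₂ : ℕ} (X₁ : Fin d₁ → Type u) (X₂ : Fin d₂ → Type v) (k s₁ s₂ : ℕ) :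
    Type (max u v) :=
  Rel s₁ s₂ × Finset (Workload d₁ d₂ k) × (Query X₁ X₂ k → ℝ)

/-- The user's choices and public parameters of the algorithm: -/
structure Config {d₁ d₂ : ℕ} (X₁ : Fin d₁ → Type u) (X₂ : Fin d₂ → Type v) (k s₁ s₂ : ℕ) where
  /-- workloads per iteration -/
  K : ℕ
  /-- number of iterations -/
  T : ℕ
  /-- bound on the degrees of the records of the original database -/
  dmax : ℕ
  /-- balance between the Gaussian and the exponential mechanism -/
  α : ℝ
  /-- the random subsampling of the workloads that have not been selected yet -/
  subsample : Finset (Workload d₁ d₂ k) → PMF (Finset (Workload d₁ d₂ k))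
  /-- the (random) initialization of the synthetic relationships -/
  init : Table X₁ s₁ → Table X₂ s₂ → PMF (Rel s₁ s₂)

/-- The privacy parameter `ε₀` that corresponds to the budget `ρ`. -/
def Config.ε₀ (c : Config X₁ X₂ k s₁ s₂) (ρ : ℝ) : ℝ := √(2 * ρ / (c.K * c.T))

/-- Append the newly selected workloads `O` to the selected ones, and the answers to their queries,
perturbed by `σ` times the standard Gaussian vector `Z`, to the noisy answers. -/
def observe (𝓑 : RelDB X₁ X₂ n₁ n₂) (σ : ℝ)
    (p : (State X₁ X₂ k s₁ s₂ × Finset (Workload d₁ d₂ k)) × (Query X₁ X₂ k → ℝ)) :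
    State X₁ X₂ k s₁ s₂ :=
  (p.1.1.1, p.1.1.2.1 ∪ p.1.2,
    fun q => if q.1 ∈ p.1.2 then marginal 𝓑 q + σ * p.2 q else p.1.1.2.2 q)

lemma measurable_observe (𝓑 : RelDB X₁ X₂ n₁ n₂) (σ : ℝ) :
    Measurable (observe (k := k) (s₁ := s₁) (s₂ := s₂) 𝓑 σ) := by
  unfold observe
  refine Measurable.prodMk (by fun_prop) (Measurable.prodMk ?_ ?_)
  · exact (measurable_of_countable (fun p : Finset (Workload d₁ d₂ k) × Finset (Workload d₁ d₂ k) =>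
      p.1 ∪ p.2)).comp (by fun_prop :
        Measurable fun p : (State X₁ X₂ k s₁ s₂ × Finset (Workload d₁ d₂ k)) × (Query X₁ X₂ k → ℝ) =>
          (p.1.1.2.1, p.1.2))
  · refine measurable_pi_lambda _ fun q => Measurable.ite ?_ (by fun_prop) (by fun_prop)
    exact (by fun_prop :
      Measurable fun p : (State X₁ X₂ k s₁ s₂ × Finset (Workload d₁ d₂ k)) × (Query X₁ X₂ k → ℝ) =>
        p.1.2) (MeasurableSet.of_discrete (s := {O | q.1 ∈ O}))

section

variable [∀ j, Fintype (X₁ j)] [∀ j, Fintype (X₂ j)]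

/-- Selection of `K` new workloads with the exponential mechanism, from a random subset of the
workloads that have not been selected yet. -/
def selectWorkloads (c : Config X₁ X₂ k s₁ s₂) (ρ : ℝ) (𝓑 : RelDB X₁ X₂ n₁ n₂)
    (𝓑syn : RelDB X₁ X₂ s₁ s₂) (sel : Finset (Workload d₁ d₂ k)) :
    PMF (Finset (Workload d₁ d₂ k)) :=
  (c.subsample selᶜ).bind fun P =>
    expSelect (fun w => √c.α * c.ε₀ ρ * (𝓑.B.count / c.dmax) * score 𝓑 𝓑syn w) c.K (P ∩ selᶜ)

/-- The selection as a Markov kernel of the current state. -/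
def selectKernel (c : Config X₁ X₂ k s₁ s₂) (ρ : ℝ) (𝓑 : RelDB X₁ X₂ n₁ n₂)
    (D₁ : Table X₁ s₁) (D₂ : Table X₂ s₂) :
    Kernel (State X₁ X₂ k s₁ s₂) (Finset (Workload d₁ d₂ k)) :=
  (Kernel.ofFunOfCountable fun p : Rel s₁ s₂ × Finset (Workload d₁ d₂ k) =>
    (selectWorkloads c ρ 𝓑 ⟨D₁, D₂, p.1⟩ p.2).toMeasure).comap
      (fun s : State X₁ X₂ k s₁ s₂ => (s.1, s.2.1)) (by fun_prop)

/-- The standard deviation of the Gaussian noise. -/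
def noiseScale (c : Config X₁ X₂ k s₁ s₂) (ρ : ℝ) (m : ℕ) : ℝ :=
  √2 * c.dmax / (m * √(1 - c.α) * c.ε₀ ρ)

/-- The access of one iteration to the private database: workload selection and noisy answers. -/
def accessKernel (c : Config X₁ X₂ k s₁ s₂) (ρ : ℝ) (𝓑 : RelDB X₁ X₂ n₁ n₂)
    (D₁ : Table X₁ s₁) (D₂ : Table X₂ s₂) :
    Kernel (State X₁ X₂ k s₁ s₂) (State X₁ X₂ k s₁ s₂) :=
  Kernel.deterministic (observe 𝓑 (noiseScale c ρ 𝓑.B.count)) (measurable_observe 𝓑 _) ∘ₖ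
    ((Kernel.id ×ₖ selectKernel c ρ 𝓑 D₁ D₂) ×ₖ
      Kernel.const _ (Measure.pi fun _ : Query X₁ X₂ k => gaussianReal 0 1))

/-- A (randomized) rule that computes new relationships from the synthetic tables, the iteration
and the state after the noisy answers have been appended, without access to the original data. -/
abbrev UpdateRule {d₁ d₂ : ℕ} (X₁ : Fin d₁ → Type u) (X₂ : Fin d₂ → Type v) (k s₁ s₂ : ℕ) :
    Type (max u v) :=
  Table X₁ s₁ → Table X₂ s₂ → ℕ → Kernel (State X₁ X₂ k s₁ s₂) (Rel s₁ s₂)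

/-- One iteration: access to the private database, then the update of `Bsyn`. -/
def stepKernel (c : Config X₁ X₂ k s₁ s₂) (U : UpdateRule X₁ X₂ k s₁ s₂) (ρ : ℝ)
    (𝓑 : RelDB X₁ X₂ n₁ n₂) (D₁ : Table X₁ s₁) (D₂ : Table X₂ s₂) (t : ℕ) :
    Kernel (State X₁ X₂ k s₁ s₂) (State X₁ X₂ k s₁ s₂) :=
  Kernel.deterministic (fun p : State X₁ X₂ k s₁ s₂ × Rel s₁ s₂ => (p.2, p.1.2)) (by fun_prop) ∘ₖ
    (Kernel.id ×ₖ U D₁ D₂ t) ∘ₖ accessKernel c ρ 𝓑 D₁ D₂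

/-- The law of the state after `t` iterations. -/
def stateLaw (c : Config X₁ X₂ k s₁ s₂) (U : UpdateRule X₁ X₂ k s₁ s₂) (ρ : ℝ)
    (𝓑 : RelDB X₁ X₂ n₁ n₂) (D₁ : Table X₁ s₁) (D₂ : Table X₂ s₂) :
    ℕ → Measure (State X₁ X₂ k s₁ s₂)
  | 0 => (c.init D₁ D₂).toMeasure.map fun B => (B, ∅, 0)
  | t + 1 => stepKernel c U ρ 𝓑 D₁ D₂ t ∘ₘ stateLaw c U ρ 𝓑 D₁ D₂ t

/-- The law of the final relationships, as a function of the synthetic tables. -/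
def buildRelations (c : Config X₁ X₂ k s₁ s₂) (U : UpdateRule X₁ X₂ k s₁ s₂) (ρ : ℝ)
    (𝓑 : RelDB X₁ X₂ n₁ n₂) : Kernel (Table X₁ s₁ × Table X₂ s₂) (Rel s₁ s₂) :=
  Kernel.ofFunOfCountable fun D => (stateLaw c U ρ 𝓑 D.1 D.2 c.T).map Prod.fst

/-- The whole mechanism: generate the two synthetic tables independently with `M₁` and `M₂`, then
build the relationships between them. -/
def synthesize (M₁ : RelDB X₁ X₂ n₁ n₂ → Measure (Table X₁ s₁))
    (M₂ : RelDB X₁ X₂ n₁ n₂ → Measure (Table X₂ s₂))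
    (c : Config X₁ X₂ k s₁ s₂) (U : UpdateRule X₁ X₂ k s₁ s₂) (ρ : ℝ)
    (𝓑 : RelDB X₁ X₂ n₁ n₂) : Measure (RelDB X₁ X₂ s₁ s₂) :=
  (((M₁ 𝓑).prod (M₂ 𝓑)) ⊗ₘ buildRelations c U ρ 𝓑).map fun p => ⟨p.1.1, p.1.2, p.2⟩

/-! ### The update by relaxed optimization and unbiased sampling -/

/-- The constraint set of the relaxed optimization: weights in `[0, 1]` that sum up to `m`. -/
def relaxedSet (s₁ s₂ m : ℕ) : Set (Fin s₁ → Fin s₂ → ℝ) :=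
  {b | (∀ i j, 0 ≤ b i j ∧ b i j ≤ 1) ∧ ∑ i, ∑ j, b i j = m}

/-- The objective `‖(1/m) Q̂ b - â‖²`. -/
def relaxedObjective (m : ℕ) (D₁ : Table X₁ s₁) (D₂ : Table X₂ s₂)
    (sel : Finset (Workload d₁ d₂ k)) (a : Query X₁ X₂ k → ℝ) (b : Fin s₁ → Fin s₂ → ℝ) : ℝ :=
  ∑ q : Query X₁ X₂ k with q.1 ∈ sel,
    (1 / m * (∑ i, ∑ j, queryVec D₁ D₂ q i j * b i j) - a q) ^ 2

/-- A (possibly randomized) solver of the relaxed optimization. -/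
abbrev Solver {d₁ d₂ : ℕ} (X₁ : Fin d₁ → Type u) (X₂ : Fin d₂ → Type v) (k s₁ s₂ : ℕ) :
    Type (max u v) :=
  Table X₁ s₁ → Table X₂ s₂ →
    Kernel (Finset (Workload d₁ d₂ k) × (Query X₁ X₂ k → ℝ)) (Fin s₁ → Fin s₂ → ℝ)

/-- The solver returns a minimizer of the relaxed optimization problem with `m` relationships. -/
def Solver.IsExact (S : Solver X₁ X₂ k s₁ s₂) (m : ℕ) : Prop :=
  ∀ D₁ D₂ sel a, ∀ᵐ b ∂(S D₁ D₂ (sel, a)),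
    b ∈ relaxedSet s₁ s₂ m ∧ IsMinOn (relaxedObjective m D₁ D₂ sel a) (relaxedSet s₁ s₂ m) b

/-- The update: solve the relaxed optimization, then sample the relationships. -/
def relaxAndSample (S : Solver X₁ X₂ k s₁ s₂) (m : ℕ) : UpdateRule X₁ X₂ k s₁ s₂ :=
  fun D₁ D₂ _ => unbiasedSampling s₁ s₂ m ∘ₖ (S D₁ D₂).comap Prod.snd measurable_snd

end

end

/-- Conversion of the budget `(ε, δ)` into a budget `ρ` of zero-concentrated privacy. -/
def rhoOf (ε δ : ℝ) : ℝ := (√(Real.log (1 / δ) + ε) - √(Real.log (1 / δ))) ^ 2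

end RelSynth

end

open RelSynth

namespace RelSynth

/-! The proof measures privacy along the iterations by zero-concentrated privacy (zCDP), whose
parameters add under adaptive composition, and converts to `(ε, δ)` only once, at the end. In the
dual form of `ZCDP`, postprocessing, composition and products are iterated integrals of test
functions, with no density to be computed.

Three estimates fix the constants. Since all private databases have `m` relationships, adjacent ones
have unnormalized marginals that differ only by the counts of one record, of total mass at most
`dmax`. Hence a workload has sensitivity `dmax / m` in total variation and `√2 * dmax / m` in the
Euclidean norm (`abs_score_sub_score_le`, `sum_sq_marginal_sub_le`). A softmax draw whose exponents
move by at most `ε` costs `ε² / 2`, by Hoeffding's lemma for the privacy loss (`ZCDP.draw_exp`). A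
Gaussian shifted by `v` standard deviations costs `v² / 2`.

So each selected workload costs `α ε₀² / 2` for its selection and `(1 - α) ε₀² / 2` for its answers.
The update of the relationships sees no private data beyond these and is free. At most `K * T`
workloads are selected, and `ε₀² = 2ρ / (K T)` bounds the total by `ρ` (`ZCDP.buildRelations`).
`ZCDP.measure_le` turns this into approximate privacy, and `IsDP.synthesize` composes it with the
generators of the two tables. The first claim is the second one for the `ρ` that solves `ρ + 2 √(ρ
log (1/δ)) = ε`. -/

/-- Zero-concentrated privacy of a pair of laws: the Rényi divergence of every order `a > 1` of `μ`
from `ν` is at most `a * ρ`. It is stated in its dual form, as a bound of the `μ`-integral by the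
norm of `L^p(ν)`, where `p = a / (a - 1)`. -/
def ZCDP {R : Type*} [MeasurableSpace R] (ρ : ℝ) (μ ν : Measure R) : Prop :=
  ∀ p : ℝ, 1 < p → ∀ f : R → ℝ≥0∞, Measurable f →
    ∫⁻ x, f x ∂μ ≤ ENNReal.ofReal (Real.exp (ρ / (p - 1))) * (∫⁻ x, f x ^ p ∂ν) ^ (1 / p)

/-! ### Calculus of zero-concentrated privacy -/

section

variable {R S : Type*} [MeasurableSpace R] [MeasurableSpace S] {μ ν : Measure R} {ρ ρ' : ℝ}

lemma ofReal_exp_mul_ofReal_exp (x y : ℝ) : ENNReal.ofReal (Real.exp x) *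
    ENNReal.ofReal (Real.exp y) = ENNReal.ofReal (Real.exp (x + y)) := by
  rw [Real.exp_add, ENNReal.ofReal_mul (Real.exp_nonneg _)]

lemma ofReal_exp_rpow (x y : ℝ) :
    ENNReal.ofReal (Real.exp x) ^ y = ENNReal.ofReal (Real.exp (x * y)) := by
  rw [ENNReal.ofReal_rpow_of_pos (Real.exp_pos _), ← Real.exp_mul]

lemma ZCDP.mono (h : ZCDP ρ μ ν) (hρ : ρ ≤ ρ') : ZCDP ρ' μ ν := by
  intro p hp f hf
  refine (h p hp f hf).trans ?_
  have : 0 < p - 1 := by linarith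
  gcongr

lemma ZCDP.rfl [IsProbabilityMeasure μ] : ZCDP 0 μ μ := by
  intro p hp f hf
  have := ENNReal.lintegral_mul_le_Lp_mul_Lq μ (Real.HolderConjugate.conjExponent hp)
    hf.aemeasurable (g := fun _ => 1) aemeasurable_const
  simpa using this

/-- Postprocessing. -/
lemma ZCDP.map (h : ZCDP ρ μ ν) {g : R → S} (hg : Measurable g) :
    ZCDP ρ (μ.map g) (ν.map g) := by
  intro p hp f hf
  rw [lintegral_map hf hg, lintegral_map (hf.pow_const p) hg]
  exact h p hp _ (hf.comp hg)

/-- Adaptive composition. -/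
lemma ZCDP.comp (h : ZCDP ρ μ ν) {κ η : Kernel R S} (hκ : ∀ᵐ x ∂μ, ZCDP ρ' (κ x) (η x)) :
    ZCDP (ρ + ρ') (κ ∘ₘ μ) (η ∘ₘ ν) := by
  intro p hp f hf
  have hp0 : p ≠ 0 := by linarith
  rw [Measure.lintegral_bind κ.aemeasurable hf.aemeasurable,
    Measure.lintegral_bind η.aemeasurable (hf.pow_const p).aemeasurable]
  have hm : Measurable fun x => ∫⁻ y, f y ^ p ∂η x := (hf.pow_const p).lintegral_kernel
  calc ∫⁻ x, ∫⁻ y, f y ∂κ x ∂μ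
      ≤ ∫⁻ x, ENNReal.ofReal (Real.exp (ρ' / (p - 1))) * (∫⁻ y, f y ^ p ∂η x) ^ (1 / p) ∂μ :=
        lintegral_mono_ae (hκ.mono fun x hx => hx p hp f hf)
    _ = ENNReal.ofReal (Real.exp (ρ' / (p - 1))) * ∫⁻ x, (∫⁻ y, f y ^ p ∂η x) ^ (1 / p) ∂μ :=
        lintegral_const_mul _ (hm.pow_const _)
    _ ≤ ENNReal.ofReal (Real.exp (ρ' / (p - 1))) * (ENNReal.ofReal (Real.exp (ρ / (p - 1))) *
          (∫⁻ x, ((∫⁻ y, f y ^ p ∂η x) ^ (1 / p)) ^ p ∂ν) ^ (1 / p)) := by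
        gcongr
        -- The test function is `x ↦ ‖f‖` in `L^p (η x)`; its norm in `L^p(ν)` is the norm of `f`
        -- under the composed law.
        exact h p hp _ (hm.pow_const _)
    _ = _ := by
        rw [← mul_assoc, ofReal_exp_mul_ofReal_exp, ← add_div, add_comm ρ']
        simp only [← ENNReal.rpow_mul, one_div_mul_cancel hp0, ENNReal.rpow_one]

/-! ### Bounds through the privacy loss `X = log (dμ/dν)` -/

/-- A bound of the moment generating function of the privacy loss implies zero-concentrated
privacy. -/
lemma ZCDP.of_withDensity {X : R → ℝ} (hX : Measurable X)
    (hν : ν = μ.withDensity fun x => ENNReal.ofReal (Real.exp (-X x)))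
    (h : ∀ t : ℝ, 0 < t → ∫⁻ x, ENNReal.ofReal (Real.exp (t * X x)) ∂μ ≤
      ENNReal.ofReal (Real.exp (t * (t + 1) * ρ))) : ZCDP ρ μ ν := by
  intro p hp f hf
  have hp1 : 0 < p - 1 := by linarith
  have hp0 : p ≠ 0 := by linarith
  have hpq := Real.HolderConjugate.conjExponent hp
  -- Hölder's inequality is applied to `f = (f e^(-X/p)) * e^(X/p)`: the first factor has the
  -- `L^p(μ)` norm of `f` in `L^p(ν)`, the second gives the moment of order `t = 1 / (p - 1)` of the
  -- privacy loss.
  have hF : Measurable fun x => f x * ENNReal.ofReal (Real.exp (-X x / p)) := by fun_prop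
  have hG : Measurable fun x => ENNReal.ofReal (Real.exp (X x / p)) := by fun_prop
  have key := ENNReal.lintegral_mul_le_Lp_mul_Lq μ hpq hF.aemeasurable hG.aemeasurable
  have h1 : ∀ x, ((fun x => f x * ENNReal.ofReal (Real.exp (-X x / p))) *
      fun x => ENNReal.ofReal (Real.exp (X x / p))) x = f x := by
    intro x
    simp only [Pi.mul_apply]
    rw [mul_assoc, ofReal_exp_mul_ofReal_exp, neg_div, neg_add_cancel]
    simp
  have h2 : ∫⁻ x, f x ^ p ∂ν =
      ∫⁻ x, (f x * ENNReal.ofReal (Real.exp (-X x / p))) ^ p ∂μ := by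
    rw [hν, lintegral_withDensity_eq_lintegral_mul _ (by fun_prop) (hf.pow_const p)]
    refine lintegral_congr fun x => ?_
    rw [ENNReal.mul_rpow_of_nonneg _ _ (by linarith), ofReal_exp_rpow, Pi.mul_apply, mul_comm,
      div_mul_cancel₀ _ hp0]
  simp only [h1, ← h2] at key
  refine key.trans ?_
  rw [mul_comm]
  gcongr
  have h3 := h (1 / (p - 1)) (by positivity)
  have h4 : ∀ x, ENNReal.ofReal (Real.exp (X x / p)) ^ p.conjExponent =
      ENNReal.ofReal (Real.exp (1 / (p - 1) * X x)) := by
    intro x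
    rw [ofReal_exp_rpow, Real.conjExponent]
    congr 2
    field_simp
  simp only [h4]
  refine (ENNReal.rpow_le_rpow h3 (one_div_nonneg.2 hpq.symm.nonneg)).trans (le_of_eq ?_)
  rw [ofReal_exp_rpow, Real.conjExponent]
  congr 2
  field_simp
  ring

/-- A bounded privacy loss implies zero-concentrated privacy. -/
lemma ZCDP.of_mem_Icc [IsProbabilityMeasure μ] [IsProbabilityMeasure ν] {X : R → ℝ}
    (hX : Measurable X) {a b : ℝ}
    (hν : ν = μ.withDensity fun x => ENNReal.ofReal (Real.exp (-X x)))
    (hab : ∀ᵐ x ∂μ, X x ∈ Set.Icc a b) : ZCDP ((b - a) ^ 2 / 8) μ ν := by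
  have hsub := hasSubgaussianMGF_of_mem_Icc hX.aemeasurable hab
  set E := ∫ x, X x ∂μ with hE
  have hc : (((‖b - a‖₊ / 2) ^ 2 : NNReal) : ℝ) = (b - a) ^ 2 / 4 := by
    push_cast
    rw [div_pow, Real.norm_eq_abs, sq_abs]
    norm_num
  have hmgf : ∀ t : ℝ, ∫⁻ x, ENNReal.ofReal (Real.exp (t * X x)) ∂μ ≤
      ENNReal.ofReal (Real.exp (t * E + (b - a) ^ 2 / 8 * t ^ 2)) := by
    intro t
    have h1 := hsub.mgf_le t
    rw [hc] at h1
    have h2 : ∀ x, ENNReal.ofReal (Real.exp (t * X x)) = ENNReal.ofReal (Real.exp (t * E)) *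
        ENNReal.ofReal (Real.exp (t * (X x - E))) := by
      intro x
      rw [ofReal_exp_mul_ofReal_exp]
      congr 2
      ring
    simp only [h2]
    rw [lintegral_const_mul _ (by fun_prop), ← ofReal_integral_eq_lintegral_ofReal
      (hsub.integrable_exp_mul t) (Filter.Eventually.of_forall fun _ => Real.exp_nonneg _)]
    rw [← ofReal_exp_mul_ofReal_exp]
    gcongr
    refine h1.trans (le_of_eq ?_)
    congr 1
    ring
  -- Hoeffding's bound at `t = -1`, where the moment is the total mass of `ν`, controls the mean of
  -- the loss (the Kullback–Leibler divergence).
  have hKL : E ≤ (b - a) ^ 2 / 8 := by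
    have h1 := hmgf (-1)
    have h2 : ∫⁻ x, ENNReal.ofReal (Real.exp (-1 * X x)) ∂μ = 1 := by
      rw [← measure_univ (μ := ν), hν, withDensity_apply _ MeasurableSet.univ]
      simp
    rw [h2, ENNReal.one_le_ofReal, Real.one_le_exp_iff] at h1
    linarith
  refine ZCDP.of_withDensity hX hν fun t ht => (hmgf t).trans ?_
  gcongr
  nlinarith

/-- A shift of the standard Gaussian. -/
lemma ZCDP.gaussianReal (v : ℝ) :
    ZCDP (v ^ 2 / 2) (gaussianReal 0 1) (ProbabilityTheory.gaussianReal v 1) := by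
  have hX : Measurable fun z : ℝ => -v * z + v ^ 2 / 2 := by fun_prop
  refine ZCDP.of_withDensity hX ?_ fun t ht => ?_
  · rw [gaussianReal_of_var_ne_zero _ one_ne_zero, gaussianReal_of_var_ne_zero _ one_ne_zero,
      ← withDensity_mul _ (measurable_gaussianPDF _ _) (by fun_prop)]
    congr 1
    ext z
    simp only [Pi.mul_apply, gaussianPDF]
    rw [← ENNReal.ofReal_mul (gaussianPDFReal_nonneg _ _ _)]
    congr 1
    simp only [gaussianPDFReal]
    rw [mul_assoc _ (Real.exp _), ← Real.exp_add]
    congr 2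
    push_cast
    ring
  · have h2 : ∀ z, ENNReal.ofReal (Real.exp (t * (-v * z + v ^ 2 / 2))) =
        ENNReal.ofReal (Real.exp (t * v ^ 2 / 2)) *
        ENNReal.ofReal (Real.exp ((-(t * v)) * z)) := by
      intro z
      rw [ofReal_exp_mul_ofReal_exp]
      congr 2
      ring
    simp only [h2]
    rw [lintegral_const_mul _ (by fun_prop), ← ofReal_integral_eq_lintegral_ofReal
      (integrable_exp_mul_gaussianReal _)
      (Filter.Eventually.of_forall fun _ => Real.exp_nonneg _)]
    have := congrFun (mgf_fun_id_gaussianReal (μ := 0) (v := 1)) (-(t * v))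
    rw [mgf] at this
    rw [this, ofReal_exp_mul_ofReal_exp]
    refine le_of_eq ?_
    congr 2
    push_cast
    ring

/-- Tensorization. -/
lemma ZCDP.pi {ι : Type*} [Fintype ι] {Y : ι → Type*} [∀ i, MeasurableSpace (Y i)]
    {μ ν : ∀ i, Measure (Y i)} [∀ i, IsProbabilityMeasure (μ i)] [∀ i, IsProbabilityMeasure (ν i)]
    {r : ι → ℝ} (h : ∀ i, ZCDP (r i) (μ i) (ν i)) :
    ZCDP (∑ i, r i) (Measure.pi μ) (Measure.pi ν) := by
  classical
  intro p hp f hf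
  have hp0 : p ≠ 0 := by linarith
  have hfp := hf.pow_const p
  -- Coordinates are integrated out one at a time, the others being frozen at `x`.
  have key : ∀ (s : Finset ι) (x : ∀ i, Y i), (∫⋯∫⁻_s, f ∂μ) x ≤
      ENNReal.ofReal (Real.exp ((∑ i ∈ s, r i) / (p - 1))) *
        (∫⋯∫⁻_s, (fun y => f y ^ p) ∂ν) x ^ (1 / p) := by
    intro s
    induction s using Finset.induction_on with
    | empty => intro x; simp [← ENNReal.rpow_mul, mul_inv_cancel₀ hp0]
    | insert i s hi ih =>
      intro x
      rw [lmarginal_insert _ hf hi, lmarginal_insert _ hfp hi, Finset.sum_insert hi]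
      have hm : Measurable fun y : Y i =>
          (∫⋯∫⁻_s, (fun y => f y ^ p) ∂ν) (Function.update x i y) :=
        (hfp.lmarginal ν).comp (measurable_update x)
      calc _ ≤ ∫⁻ y, ENNReal.ofReal (Real.exp ((∑ i ∈ s, r i) / (p - 1))) *
              (∫⋯∫⁻_s, (fun y => f y ^ p) ∂ν) (Function.update x i y) ^ (1 / p) ∂μ i :=
            lintegral_mono fun y => ih _
        _ = ENNReal.ofReal (Real.exp ((∑ i ∈ s, r i) / (p - 1))) *
              ∫⁻ y, (∫⋯∫⁻_s, (fun y => f y ^ p) ∂ν) (Function.update x i y) ^ (1 / p) ∂μ i :=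
            lintegral_const_mul _ (hm.pow_const _)
        _ ≤ _ := mul_le_mul_right (h i p hp _ (hm.pow_const _)) _
        _ = _ := by
            rw [← mul_assoc, ofReal_exp_mul_ofReal_exp, ← add_div, add_comm (r i)]
            simp only [← ENNReal.rpow_mul, one_div_mul_cancel hp0, ENNReal.rpow_one]
  by_cases hY : Nonempty (∀ i, Y i)
  · obtain ⟨x⟩ := hY
    simpa using key Finset.univ x
  · rw [not_nonempty_iff] at hY
    simp

/-! ### From zero-concentrated to approximate privacy -/

/-- Conversion to approximate privacy. -/
lemma ZCDP.measure_le [IsProbabilityMeasure μ] [IsProbabilityMeasure ν] (h : ZCDP ρ μ ν)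
    (hρ : 0 < ρ) {δ : ℝ} (hδ : 0 < δ) (hδ1 : δ ≤ 1) {O : Set R} (hO : MeasurableSet O) :
    μ O ≤ ENNReal.ofReal (Real.exp (ρ + 2 * √(ρ * Real.log (1 / δ)))) * ν O +
      ENNReal.ofReal δ := by
  -- At `δ = 1` the bound is trivial, while the exponent `p = 1 + 1 / t` chosen below would
  -- degenerate, as `t = 0`.
  rcases hδ1.eq_or_lt with rfl | hδ1
  · simpa using prob_le_one.trans le_add_self
  have hL : 0 < Real.log (1 / δ) := Real.log_pos (by rw [lt_div_iff₀ hδ]; linarith)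
  set t := √(Real.log (1 / δ) / ρ) with ht
  have ht0 : 0 < t := Real.sqrt_pos.2 (by positivity)
  have hLt : Real.log (1 / δ) = ρ * t ^ 2 := by
    rw [ht, Real.sq_sqrt (by positivity)]; field_simp
  have hδt : δ = Real.exp (-(ρ * t ^ 2)) := by
    rw [← hLt, one_div, Real.log_inv, neg_neg, Real.exp_log hδ]
  have hs : √(ρ * Real.log (1 / δ)) = ρ * t := by
    rw [hLt, show ρ * (ρ * t ^ 2) = (ρ * t) ^ 2 by ring, Real.sqrt_sq (by positivity)]
  have hp : 1 < 1 + 1 / t := by have : 0 < 1 / t := by positivity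
                                linarith
  have key := h (1 + 1 / t) hp (O.indicator 1) (measurable_one.indicator hO)
  have h1 : ∀ x, (O.indicator (1 : R → ℝ≥0∞) x) ^ (1 + 1 / t) = O.indicator 1 x := by
    intro x
    by_cases hx : x ∈ O
    · simp [hx]
    · simp only [hx, not_false_eq_true, Set.indicator_of_notMem]
      exact ENNReal.zero_rpow_of_pos (by linarith)
  simp only [h1, lintegral_indicator_one hO] at key
  refine key.trans ?_
  rw [hs]
  by_cases hν : ν O = 0
  · rw [hν, ENNReal.zero_rpow_of_pos (by positivity)]
    simp
  have hx0 : 0 < (ν O).toReal := ENNReal.toReal_pos hν (measure_ne_top _ _)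
  obtain ⟨s, hs'⟩ : ∃ s, ν O = ENNReal.ofReal (Real.exp s) :=
    ⟨Real.log (ν O).toReal, by rw [Real.exp_log hx0, ENNReal.ofReal_toReal (measure_ne_top _ _)]⟩
  rw [hs', ofReal_exp_rpow, ofReal_exp_mul_ofReal_exp, ofReal_exp_mul_ofReal_exp, hδt]
  have e1 : ρ / (1 + 1 / t - 1) + s * (1 / (1 + 1 / t)) = ρ * t + s * t / (t + 1) := by
    field_simp
    ring
  rw [e1]
  -- With `ν O = e^s`, the bound is `e^(ρt + st/(t+1))`, while the two terms of the target are `e^(ρ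
  -- + 2ρt + s)` and `δ = e^(-ρt²)`. All three agree at `s = -ρ(1+t)²`; above this value the first
  -- term alone suffices, below it the second.
  rcases le_total (-(ρ * (1 + t) ^ 2)) s with hcase | hcase
  · refine le_trans (ENNReal.ofReal_le_ofReal (Real.exp_le_exp.2 ?_)) le_self_add
    rw [← sub_nonneg]
    have : ρ + 2 * (ρ * t) + s - (ρ * t + s * t / (t + 1)) = (s + ρ * (1 + t) ^ 2) / (t + 1) := by
      field_simp
      ring
    rw [this]
    exact div_nonneg (by linarith) (by positivity)
  · refine le_trans (ENNReal.ofReal_le_ofReal (Real.exp_le_exp.2 ?_)) le_add_self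
    rw [← sub_nonneg]
    have : -(ρ * t ^ 2) - (ρ * t + s * t / (t + 1)) = t * (-(ρ * (1 + t) ^ 2) - s) / (t + 1) := by
      field_simp
      ring
    rw [this]
    exact div_nonneg (mul_nonneg ht0.le (by linarith)) (by positivity)

/-- Approximate privacy extends from events to tests. -/
lemma lintegral_le_of_measure_le {c δ : ℝ≥0∞} (h : ∀ O, MeasurableSet O → μ O ≤ c * ν O + δ)
    {f : R → ℝ≥0∞} (hf : Measurable f) (hf1 : ∀ x, f x ≤ 1) :
    ∫⁻ x, f x ∂μ ≤ c * ∫⁻ x, f x ∂ν + δ := by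
  have hft : ∀ x, f x = ENNReal.ofReal (f x).toReal := fun x =>
    (ENNReal.ofReal_toReal (ne_top_of_le_ne_top ENNReal.one_ne_top (hf1 x))).symm
  have hg : Measurable fun x => (f x).toReal := hf.ennreal_toReal
  -- Layer cake: the hypothesis is applied to every superlevel set. Those at levels above `1` are
  -- empty, so `δ` is only paid over a unit interval.
  have layer : ∀ μ : Measure R, ∫⁻ x, f x ∂μ = ∫⁻ t in Set.Ioi (0 : ℝ), μ {x | t ≤ (f x).toReal} := by
    intro μ
    rw [lintegral_congr hft, lintegral_eq_lintegral_meas_le μ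
      (Filter.Eventually.of_forall fun x => ENNReal.toReal_nonneg) hg.aemeasurable]
  rw [layer μ, layer ν]
  have hmeas : Measurable fun t : ℝ => ν {x | t ≤ (f x).toReal} :=
    Antitone.measurable fun s t hst => measure_mono fun x hx => hst.trans hx
  calc ∫⁻ t in Set.Ioi (0 : ℝ), μ {x | t ≤ (f x).toReal}
      ≤ ∫⁻ t in Set.Ioi (0 : ℝ), (c * ν {x | t ≤ (f x).toReal} +
          (Set.Iic 1).indicator (fun _ => δ) t) := by
        refine lintegral_mono fun t => ?_
        by_cases ht : t ≤ 1
        · rw [Set.indicator_of_mem (Set.mem_Iic.2 ht)]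
          exact h _ (measurableSet_le measurable_const hg)
        · have : {x | t ≤ (f x).toReal} = ∅ := by
            ext x
            have : (f x).toReal ≤ 1 := ENNReal.toReal_le_of_le_ofReal zero_le_one (by simpa using hf1 x)
            simp only [Set.mem_ofPred_eq, Set.mem_empty_iff_false, iff_false]
            linarith
          simp [this]
    _ = _ := by
        rw [lintegral_add_right _ (measurable_const.indicator measurableSet_Iic),
          lintegral_const_mul _ hmeas, lintegral_indicator_const measurableSet_Iic,
          Measure.restrict_apply measurableSet_Iic, Set.inter_comm, Set.Ioi_inter_Iic]
        simp

end

/-! ### The exponential mechanism -/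

/-- With the normalizer inside the exponent, the ratio of two such laws is again an exponential, as
`ZCDP.of_withDensity` requires. -/
lemma draw_exp_apply {β : Type*} [DecidableEq β] {s : Finset β} (hs : s.Nonempty) (u : β → ℝ) (a₀ i : β) :
    draw s (fun j => Real.exp (u j)) a₀ i = if i ∈ s then
      ENNReal.ofReal (Real.exp (u i - Real.log (∑ j ∈ s, Real.exp (u j)))) else 0 := by
  have hZ : 0 < ∑ j ∈ s, Real.exp (u j) := Finset.sum_pos (fun j _ => Real.exp_pos _) hs
  have hsum : ∑ j ∈ s, ENNReal.ofReal (Real.exp (u j)) =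
      ENNReal.ofReal (∑ j ∈ s, Real.exp (u j)) :=
    (ENNReal.ofReal_sum_of_nonneg fun j _ => Real.exp_nonneg _).symm
  have h0 : ¬∑ j ∈ s, ENNReal.ofReal (Real.exp (u j)) = 0 := by
    rw [hsum, ENNReal.ofReal_eq_zero, not_le]
    exact hZ
  rw [draw, dif_neg h0, PMF.ofFinset_apply, hsum, ← ENNReal.ofReal_div_of_pos hZ, Real.exp_sub,
    Real.exp_log hZ]

section

variable {β γ : Type*} [MeasurableSpace β] [DiscreteMeasurableSpace β] [Countable β]
  [MeasurableSpace γ] {ρ ρ' : ℝ}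

lemma toMeasure_bind_eq_comp [DiscreteMeasurableSpace γ] (p : PMF β) (q : β → PMF γ) :
    (p.bind q).toMeasure = (Kernel.ofFunOfCountable fun b => (q b).toMeasure) ∘ₘ p.toMeasure := by
  ext s hs
  rw [PMF.toMeasure_bind_apply _ _ _ hs, Measure.bind_apply hs (Kernel.aemeasurable _),
    lintegral_countable']
  refine tsum_congr fun b => ?_
  rw [PMF.toMeasure_apply_singleton _ _ (measurableSet_singleton b), mul_comm]
  rfl

lemma ZCDP.pmf_bind [DiscreteMeasurableSpace γ] {p p' : PMF β} {q q' : β → PMF γ}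
    (h : ZCDP ρ p.toMeasure p'.toMeasure)
    (hq : ∀ b ∈ p.support, ZCDP ρ' (q b).toMeasure (q' b).toMeasure) :
    ZCDP (ρ + ρ') (p.bind q).toMeasure (p'.bind q').toMeasure := by
  rw [toMeasure_bind_eq_comp, toMeasure_bind_eq_comp]
  refine h.comp ?_
  rw [ae_iff_of_countable]
  intro b hb
  rw [PMF.toMeasure_apply_singleton _ _ (measurableSet_singleton b)] at hb
  exact hq b hb

variable [DecidableEq β]

/-- The normalizers only translate the privacy loss by a constant `c`, and the Hoeffding bound
depends on the length `2ε` of its range alone. Bounding the normalizers separately would lose a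
factor of four. -/
lemma ZCDP.draw_exp {s : Finset β} (hs : s.Nonempty) {u u' : β → ℝ} {ε : ℝ}
    (h : ∀ i ∈ s, |u i - u' i| ≤ ε) (a₀ : β) :
    ZCDP (ε ^ 2 / 2) (draw s (fun j => Real.exp (u j)) a₀).toMeasure
      (draw s (fun j => Real.exp (u' j)) a₀).toMeasure := by
  set c := Real.log (∑ j ∈ s, Real.exp (u j)) - Real.log (∑ j ∈ s, Real.exp (u' j)) with hc
  have hX : Measurable fun i => u i - u' i - c := measurable_of_countable _
  have key := ZCDP.of_mem_Icc (μ := (draw s (fun j => Real.exp (u j)) a₀).toMeasure)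
    (ν := (draw s (fun j => Real.exp (u' j)) a₀).toMeasure) hX (a := -ε - c) (b := ε - c) ?_ ?_
  · refine key.mono (le_of_eq ?_)
    ring
  · rw [Measure.ext_iff_singleton]
    intro i
    rw [withDensity_apply _ (measurableSet_singleton i), lintegral_singleton,
      PMF.toMeasure_apply_singleton _ _ (measurableSet_singleton i),
      PMF.toMeasure_apply_singleton _ _ (measurableSet_singleton i),
      draw_exp_apply hs, draw_exp_apply hs]
    split_ifs
    · rw [ofReal_exp_mul_ofReal_exp, hc]
      congr 2
      ring
    · simp
  · rw [ae_iff_of_countable]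
    intro i hi
    rw [PMF.toMeasure_apply_singleton _ _ (measurableSet_singleton i), draw_exp_apply hs] at hi
    have his : i ∈ s := by
      by_contra hn
      simp [hn] at hi
    have := abs_le.1 (h i his)
    constructor <;> linarith [this.1, this.2]

/-- Given the workload drawn in a round, both runs continue from the same remaining set, so the
rounds compose adaptively. -/
lemma ZCDP.expSelect [MeasurableSpace (Finset β)] [DiscreteMeasurableSpace (Finset β)]
    {u u' : β → ℝ} {ε : ℝ} (h : ∀ i, |u i - u' i| ≤ ε) (K : ℕ) (P : Finset β) :
    ZCDP (K * (ε ^ 2 / 2)) (expSelect u K P).toMeasure (expSelect u' K P).toMeasure := by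
  induction K generalizing P with
  | zero =>
    simp only [RelSynth.expSelect, Nat.cast_zero, zero_mul]
    exact ZCDP.rfl
  | succ K ih =>
    by_cases hP : P.Nonempty
    · simp only [RelSynth.expSelect, hP, dif_pos]
      refine (ZCDP.pmf_bind (ZCDP.draw_exp hP (fun i _ => h i) _) fun w _ => ?_).mono
        (ρ := ε ^ 2 / 2 + K * (ε ^ 2 / 2)) (le_of_eq (by push_cast; ring))
      have hins : Measurable (insert w : Finset β → Finset β) := Measurable.of_discrete
      rw [← PMF.toMeasure_map _ _ hins, ← PMF.toMeasure_map _ _ hins]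
      exact (ih _).map hins
    · simp only [RelSynth.expSelect, hP, dif_neg, not_false_eq_true]
      exact ZCDP.rfl.mono (by positivity)

end

lemma card_le_of_mem_support_expSelect {β : Type*} [DecidableEq β] (u : β → ℝ) (K : ℕ)
    (P : Finset β) {O : Finset β} (hO : O ∈ (expSelect u K P).support) : O.card ≤ K := by
  induction K generalizing P O with
  | zero =>
    rw [expSelect, PMF.mem_support_pure_iff] at hO
    simp [hO]
  | succ K ih =>
    by_cases hP : P.Nonempty
    · simp only [expSelect, hP, dif_pos, PMF.mem_support_bind_iff, PMF.mem_support_map_iff] at hO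
      obtain ⟨w, -, O', hO', rfl⟩ := hO
      exact (Finset.card_insert_le _ _).trans (Nat.succ_le_succ (ih _ hO'))
    · simp only [expSelect, hP, dif_neg, not_false_eq_true, PMF.mem_support_pure_iff] at hO
      simp [hO]

/-! ### Sensitivity -/

section

variable {d₁ d₂ : ℕ} {X₁ : Fin d₁ → Type*} {X₂ : Fin d₂ → Type*} {n₁ n₂ k : ℕ}

lemma queryVec_nonneg (D₁ : Table X₁ n₁) (D₂ : Table X₂ n₂) (q : Query X₁ X₂ k) (i : Fin n₁)
    (j : Fin n₂) : 0 ≤ queryVec D₁ D₂ q i j := by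
  unfold queryVec
  split_ifs <;> norm_num

variable [∀ j, Fintype (X₁ j)] [∀ j, Fintype (X₂ j)]

/-- A pair of records satisfies exactly one query of a workload, the one with its own feature
values. -/
lemma sum_queryVec (D₁ : Table X₁ n₁) (D₂ : Table X₂ n₂) (w : Workload d₁ d₂ k) (i : Fin n₁)
    (j : Fin n₂) :
    ∑ y : ((j : w.1.1) → X₁ j) × ((j : w.1.2) → X₂ j),
      queryVec D₁ D₂ (⟨w, y⟩ : Query X₁ X₂ k) i j = 1 := by
  classical
  let y₀ : ((j : w.1.1) → X₁ j) × ((j : w.1.2) → X₂ j) := (fun a => D₁ i a, fun a => D₂ j a)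
  rw [Finset.sum_eq_single y₀]
  · simp [queryVec, y₀]
  · intro y _ hy
    rw [queryVec, if_neg]
    rintro ⟨h1, h2⟩
    exact hy (Prod.ext (funext fun a => (h1 a).symm) (funext fun a => (h2 a).symm))
  · simp

/-- The index type `ι` runs along a row or a column of the bi-adjacency matrix, so that the right
side becomes a degree. -/
lemma sum_ite_queryVec {ι : Type*} [Fintype ι] (D₁ : Table X₁ n₁) (D₂ : Table X₂ n₂)
    (w : Workload d₁ d₂ k) (b : ι → Bool) (f : ι → Fin n₁) (g : ι → Fin n₂) :
    ∑ y : ((j : w.1.1) → X₁ j) × ((j : w.1.2) → X₂ j), ∑ l,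
      (if b l then queryVec D₁ D₂ (⟨w, y⟩ : Query X₁ X₂ k) (f l) (g l) else 0) =
      ((∑ l, if b l then 1 else 0 : ℕ) : ℝ) := by
  rw [Finset.sum_comm]
  push_cast
  refine Finset.sum_congr rfl fun l _ => ?_
  split_ifs
  · rw [sum_queryVec]
  · simp

/-- The unnormalized marginals of adjacent databases agree up to nonnegative terms of total mass at
most `dmax`. -/
lemma exists_marginal_sub_marginal {𝓑 𝓑' : RelDB X₁ X₂ n₁ n₂} {dmax m : ℕ}
    (h : 𝓑 ∈ BoundedDB X₁ X₂ n₁ n₂ dmax m) (h' : 𝓑' ∈ BoundedDB X₁ X₂ n₁ n₂ dmax m)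
    (hadj : Adjacent 𝓑 𝓑') (w : Workload d₁ d₂ k) :
    ∃ A A' : ((j : w.1.1) → X₁ j) × ((j : w.1.2) → X₂ j) → ℝ,
      (∀ y, 0 ≤ A y) ∧ (∀ y, 0 ≤ A' y) ∧ ∑ y, A y ≤ dmax ∧ ∑ y, A' y ≤ dmax ∧
      ∀ y, marginal 𝓑 (⟨w, y⟩ : Query X₁ X₂ k) - marginal 𝓑' (⟨w, y⟩ : Query X₁ X₂ k) =
        (A y - A' y) / m := by
  obtain ⟨D₁, D₂, B⟩ := 𝓑
  obtain ⟨D₁', D₂', B'⟩ := 𝓑'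
  obtain ⟨hm, h1, h2⟩ := h
  obtain ⟨hm', h1', h2'⟩ := h'
  simp only at hm h1 h2 hm' h1' h2'
  simp only [marginal, hm, hm']
  rcases hadj with ⟨i, hD, hD', hB⟩ | ⟨j, hD, hD', hB⟩
  · simp only at hD hD' hB
    subst hD'
    -- The witnesses are the counts of the modified record before and after the change; their masses
    -- are its degrees. The other rows cancel because both marginals are normalized by the same `m`.
    refine ⟨fun y => ∑ j, if B i j then queryVec D₁ D₂ (⟨w, y⟩ : Query X₁ X₂ k) i j else 0,
      fun y => ∑ j, if B' i j then queryVec D₁' D₂ (⟨w, y⟩ : Query X₁ X₂ k) i j else 0,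
      fun y => Finset.sum_nonneg fun j _ => ?_, fun y => Finset.sum_nonneg fun j _ => ?_,
      ?_, ?_, fun y => ?_⟩
    · split_ifs <;> simp [queryVec_nonneg]
    · split_ifs <;> simp [queryVec_nonneg]
    · rw [sum_ite_queryVec D₁ D₂ w (fun j => B i j) (fun _ => i) fun j => j]
      exact_mod_cast h1 i
    · rw [sum_ite_queryVec D₁' D₂ w (fun j => B' i j) (fun _ => i) fun j => j]
      exact_mod_cast h1' i
    · rw [← sub_div, ← Finset.sum_sub_distrib, Finset.sum_eq_single i]
      · intro i' _ hi'
        rw [sub_eq_zero]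
        refine Finset.sum_congr rfl fun j _ => ?_
        unfold queryVec
        rw [hB i' hi' j, hD i' hi']
      · simp
  · simp only at hD hD' hB
    subst hD'
    refine ⟨fun y => ∑ i, if B i j then queryVec D₁ D₂ (⟨w, y⟩ : Query X₁ X₂ k) i j else 0,
      fun y => ∑ i, if B' i j then queryVec D₁ D₂' (⟨w, y⟩ : Query X₁ X₂ k) i j else 0,
      fun y => Finset.sum_nonneg fun i _ => ?_, fun y => Finset.sum_nonneg fun i _ => ?_,
      ?_, ?_, fun y => ?_⟩
    · split_ifs <;> simp [queryVec_nonneg]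
    · split_ifs <;> simp [queryVec_nonneg]
    · rw [sum_ite_queryVec D₁ D₂ w (fun i => B i j) (fun i => i) fun _ => j]
      exact_mod_cast h2 j
    · rw [sum_ite_queryVec D₁ D₂' w (fun i => B' i j) (fun i => i) fun _ => j]
      exact_mod_cast h2' j
    · rw [← sub_div, Finset.sum_comm, Finset.sum_comm (s := Finset.univ (α := Fin n₁)),
        ← Finset.sum_sub_distrib, Finset.sum_eq_single j]
      · intro j' _ hj'
        rw [sub_eq_zero]
        refine Finset.sum_congr rfl fun i _ => ?_
        unfold queryVec
        rw [hB j' hj' i, hD j' hj']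
      · simp

lemma sum_abs_marginal_sub_le {𝓑 𝓑' : RelDB X₁ X₂ n₁ n₂} {dmax m : ℕ}
    (h : 𝓑 ∈ BoundedDB X₁ X₂ n₁ n₂ dmax m) (h' : 𝓑' ∈ BoundedDB X₁ X₂ n₁ n₂ dmax m)
    (hadj : Adjacent 𝓑 𝓑') (w : Workload d₁ d₂ k) :
    ∑ y, |marginal 𝓑 (⟨w, y⟩ : Query X₁ X₂ k) - marginal 𝓑' (⟨w, y⟩ : Query X₁ X₂ k)| ≤
      2 * (dmax / m) := by
  obtain ⟨A, A', hA, hA', hs, hs', heq⟩ := exists_marginal_sub_marginal h h' hadj w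
  simp only [heq]
  calc ∑ y, |(A y - A' y) / m| ≤ ∑ y, (A y + A' y) / m := by
        refine Finset.sum_le_sum fun y _ => ?_
        rw [abs_div, Nat.abs_cast]
        gcongr
        exact (abs_sub _ _).trans_eq (by rw [abs_of_nonneg (hA y), abs_of_nonneg (hA' y)])
    _ = (∑ y, A y + ∑ y, A' y) / m := by rw [← Finset.sum_div, Finset.sum_add_distrib]
    _ ≤ (dmax + dmax) / m := by gcongr
    _ = _ := by ring

lemma sum_sq_marginal_sub_le {𝓑 𝓑' : RelDB X₁ X₂ n₁ n₂} {dmax m : ℕ}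
    (h : 𝓑 ∈ BoundedDB X₁ X₂ n₁ n₂ dmax m) (h' : 𝓑' ∈ BoundedDB X₁ X₂ n₁ n₂ dmax m)
    (hadj : Adjacent 𝓑 𝓑') (w : Workload d₁ d₂ k) :
    ∑ y, (marginal 𝓑 (⟨w, y⟩ : Query X₁ X₂ k) - marginal 𝓑' (⟨w, y⟩ : Query X₁ X₂ k)) ^ 2 ≤
      2 * (dmax / m) ^ 2 := by
  obtain ⟨A, A', hA, hA', hs, hs', heq⟩ := exists_marginal_sub_marginal h h' hadj w
  have hsq : ∀ {C : ((j : w.1.1) → X₁ j) × ((j : w.1.2) → X₂ j) → ℝ}, (∀ y, 0 ≤ C y) →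
      ∑ y, C y ≤ dmax → ∑ y, C y ^ 2 ≤ (dmax : ℝ) ^ 2 := fun {C} hC hCs =>
    (Finset.sum_sq_le_sq_sum_of_nonneg fun y _ => hC y).trans
      (pow_le_pow_left₀ (Finset.sum_nonneg fun y _ => hC y) hCs 2)
  simp only [heq]
  calc ∑ y, ((A y - A' y) / m) ^ 2 ≤ ∑ y, (A y ^ 2 + A' y ^ 2) / (m : ℝ) ^ 2 := by
        refine Finset.sum_le_sum fun y _ => ?_
        rw [div_pow]
        gcongr
        -- The cross term `-2 A A'` is nonpositive. This gives the factor `2` instead of `4`, hence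
        -- the `√2` in `noiseScale`.
        nlinarith [mul_nonneg (hA y) (hA' y)]
    _ = (∑ y, A y ^ 2 + ∑ y, A' y ^ 2) / (m : ℝ) ^ 2 := by
        rw [← Finset.sum_div, Finset.sum_add_distrib]
    _ ≤ ((dmax : ℝ) ^ 2 + (dmax : ℝ) ^ 2) / (m : ℝ) ^ 2 := by
        gcongr
        · exact hsq hA hs
        · exact hsq hA' hs'
    _ = _ := by ring

lemma abs_score_sub_score_le {𝓑 𝓑' : RelDB X₁ X₂ n₁ n₂} {dmax m : ℕ}
    (h : 𝓑 ∈ BoundedDB X₁ X₂ n₁ n₂ dmax m) (h' : 𝓑' ∈ BoundedDB X₁ X₂ n₁ n₂ dmax m)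
    (hadj : Adjacent 𝓑 𝓑') {s₁ s₂ : ℕ} (𝓑syn : RelDB X₁ X₂ s₁ s₂) (w : Workload d₁ d₂ k) :
    |score 𝓑 𝓑syn w - score 𝓑' 𝓑syn w| ≤ dmax / m := by
  rw [score, score, ← mul_sub, ← Finset.sum_sub_distrib, abs_mul, abs_of_nonneg (by norm_num)]
  have h1 := (Finset.abs_sum_le_sum_abs (fun y =>
      |marginal 𝓑 (⟨w, y⟩ : Query X₁ X₂ k) - marginal 𝓑syn (⟨w, y⟩ : Query X₁ X₂ k)| -
      |marginal 𝓑' (⟨w, y⟩ : Query X₁ X₂ k) - marginal 𝓑syn (⟨w, y⟩ : Query X₁ X₂ k)|)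
      Finset.univ).trans (Finset.sum_le_sum fun y _ => abs_abs_sub_abs_le _ _)
  simp only [sub_sub_sub_cancel_right] at h1
  linarith [h1.trans (sum_abs_marginal_sub_le h h' hadj w)]

end

/-! ### The Gaussian mechanism -/

/-- Both laws are images under `z ↦ x + σ z`, of the standard Gaussian and of its shift by `(x' - x)
/ σ`. -/
lemma ZCDP.affine_gaussianReal {σ : ℝ} (hσ : 0 < σ) (x x' : ℝ) :
    ZCDP (((x - x') / σ) ^ 2 / 2) ((ProbabilityTheory.gaussianReal 0 1).map fun z => x + σ * z)
      ((ProbabilityTheory.gaussianReal 0 1).map fun z => x' + σ * z) := by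
  have h := (ZCDP.gaussianReal ((x' - x) / σ)).map (g := fun z => x + σ * z) (by fun_prop)
  have h1 : ProbabilityTheory.gaussianReal ((x' - x) / σ) 1 =
      (ProbabilityTheory.gaussianReal 0 1).map fun z => z + (x' - x) / σ := by
    rw [gaussianReal_map_add_const, zero_add]
  rw [h1, Measure.map_map (by fun_prop) (by fun_prop)] at h
  have h2 : ((fun z => x + σ * z) ∘ fun z => z + (x' - x) / σ) = fun z => x' + σ * z := by
    ext z
    simp only [Function.comp_apply]
    field_simp
    ring
  rw [h2] at h
  refine h.mono (le_of_eq ?_)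
  ring

section

variable {d₁ d₂ : ℕ} {X₁ : Fin d₁ → Type*} {X₂ : Fin d₂ → Type*} {k n₁ n₂ s₁ s₂ : ℕ}

lemma pos_of_mem_boundedDB {𝓑 : RelDB X₁ X₂ n₁ n₂} {dmax m : ℕ} (hm : 0 < m)
    (h : 𝓑 ∈ BoundedDB X₁ X₂ n₁ n₂ dmax m) : 0 < dmax := by
  by_contra h0
  obtain ⟨hc, h1, -⟩ := h
  have : 𝓑.B.count = ∑ i, 𝓑.B.deg₁ i := Eq.refl _
  rw [Finset.sum_eq_zero fun i _ => by have := h1 i; omega] at this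
  omega

variable [∀ j, Fintype (X₁ j)] [∀ j, Fintype (X₂ j)]

/-- For a fixed selection `O` the answers are independent: those outside `O` are copied from the
state at no cost, and the shifts in each workload of `O` add up to the squared Euclidean
sensitivity. -/
lemma ZCDP.observe {𝓑 𝓑' : RelDB X₁ X₂ n₁ n₂} {dmax m : ℕ}
    (h : 𝓑 ∈ BoundedDB X₁ X₂ n₁ n₂ dmax m) (h' : 𝓑' ∈ BoundedDB X₁ X₂ n₁ n₂ dmax m)
    (hadj : Adjacent 𝓑 𝓑') {σ : ℝ} (s : State X₁ X₂ k s₁ s₂) {O : Finset (Workload d₁ d₂ k)}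
    (hσ : O.Nonempty → 0 < σ) :
    ZCDP (O.card * (dmax / m / σ) ^ 2)
      ((Measure.pi fun _ : Query X₁ X₂ k => ProbabilityTheory.gaussianReal 0 1).map
        fun z => RelSynth.observe 𝓑 σ ((s, O), z))
      ((Measure.pi fun _ : Query X₁ X₂ k => ProbabilityTheory.gaussianReal 0 1).map
        fun z => RelSynth.observe 𝓑' σ ((s, O), z)) := by
  let g : RelDB X₁ X₂ n₁ n₂ → Query X₁ X₂ k → ℝ → ℝ := fun 𝓑 q z =>
    if q.1 ∈ O then marginal 𝓑 q + σ * z else s.2.2 q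
  have hg : ∀ 𝓑 q, Measurable (g 𝓑 q) := by
    intro 𝓑 q
    by_cases hq : q.1 ∈ O
    · simp only [g, hq, if_true]; fun_prop
    · simp only [g, hq, if_false]; fun_prop
  have hF : Measurable fun a : Query X₁ X₂ k → ℝ => ((s.1, s.2.1 ∪ O, a) : State X₁ X₂ k s₁ s₂) := by
    fun_prop
  have hprob : ∀ 𝓑 q, IsProbabilityMeasure ((ProbabilityTheory.gaussianReal 0 1).map (g 𝓑 q)) :=
    fun 𝓑 q => Measure.isProbabilityMeasure_map (hg 𝓑 q).aemeasurable
  have hmap : ∀ 𝓑 : RelDB X₁ X₂ n₁ n₂,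
      (Measure.pi fun _ : Query X₁ X₂ k => ProbabilityTheory.gaussianReal 0 1).map
        (fun z => RelSynth.observe 𝓑 σ ((s, O), z)) =
      (Measure.pi fun q => (ProbabilityTheory.gaussianReal 0 1).map (g 𝓑 q)).map
        fun a => ((s.1, s.2.1 ∪ O, a) : State X₁ X₂ k s₁ s₂) := by
    intro 𝓑
    have hG : Measurable fun (z : Query X₁ X₂ k → ℝ) q => g 𝓑 q (z q) :=
      measurable_pi_lambda _ fun q => (hg 𝓑 q).comp (measurable_pi_apply q)
    rw [← Measure.pi_map_pi fun q => (hg 𝓑 q).aemeasurable]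
    exact (Measure.map_map hF hG).symm
  have hr : ∀ q : Query X₁ X₂ k,
      ZCDP (if q.1 ∈ O then ((marginal 𝓑 q - marginal 𝓑' q) / σ) ^ 2 / 2 else 0)
        ((ProbabilityTheory.gaussianReal 0 1).map (g 𝓑 q))
        ((ProbabilityTheory.gaussianReal 0 1).map (g 𝓑' q)) := by
    intro q
    by_cases hq : q.1 ∈ O
    · simp only [g, hq, if_true]
      exact ZCDP.affine_gaussianReal (hσ ⟨_, hq⟩) _ _
    · have := hprob 𝓑 q
      simp only [g, hq, if_false] at this ⊢
      exact ZCDP.rfl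
  rw [hmap, hmap]
  refine ((ZCDP.pi hr).map hF).mono ?_
  rw [Fintype.sum_sigma]
  calc ∑ w, ∑ y : ((j : w.1.1) → X₁ j) × ((j : w.1.2) → X₂ j),
        (if w ∈ O then ((marginal 𝓑 (⟨w, y⟩ : Query X₁ X₂ k) -
          marginal 𝓑' (⟨w, y⟩ : Query X₁ X₂ k)) / σ) ^ 2 / 2 else 0)
      ≤ ∑ w, if w ∈ O then ((dmax : ℝ) / m / σ) ^ 2 else 0 := by
        refine Finset.sum_le_sum fun w _ => ?_
        split_ifs
        · simp only [div_pow _ σ]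
          rw [← Finset.sum_div, ← Finset.sum_div, div_right_comm]
          gcongr
          linarith [sum_sq_marginal_sub_le h h' hadj w]
        · simp
    _ = _ := by simp

/-! ### The iterations -/

variable (c : Config X₁ X₂ k s₁ s₂) (U : UpdateRule X₁ X₂ k s₁ s₂) (ρ : ℝ)

instance (𝓑 : RelDB X₁ X₂ n₁ n₂) (D₁ : Table X₁ s₁) (D₂ : Table X₂ s₂) :
    IsMarkovKernel (selectKernel c ρ 𝓑 D₁ D₂) :=
  ⟨fun s => PMF.toMeasure.isProbabilityMeasure (selectWorkloads c ρ 𝓑 ⟨D₁, D₂, s.1⟩ s.2.1)⟩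

instance (𝓑 : RelDB X₁ X₂ n₁ n₂) (D₁ : Table X₁ s₁) (D₂ : Table X₂ s₂) :
    IsMarkovKernel (accessKernel c ρ 𝓑 D₁ D₂) := by
  unfold accessKernel
  infer_instance

instance [∀ D₁ D₂ t, IsMarkovKernel (U D₁ D₂ t)] (𝓑 : RelDB X₁ X₂ n₁ n₂) (D₁ : Table X₁ s₁)
    (D₂ : Table X₂ s₂) (t : ℕ) : IsMarkovKernel (stepKernel c U ρ 𝓑 D₁ D₂ t) := by
  unfold stepKernel
  infer_instance

instance [∀ D₁ D₂ t, IsMarkovKernel (U D₁ D₂ t)] (𝓑 : RelDB X₁ X₂ n₁ n₂) (D₁ : Table X₁ s₁)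
    (D₂ : Table X₂ s₂) (t : ℕ) : IsProbabilityMeasure (stateLaw c U ρ 𝓑 D₁ D₂ t) := by
  induction t with
  | zero => exact Measure.isProbabilityMeasure_map (by fun_prop)
  | succ t ih => unfold stateLaw; infer_instance

instance [∀ D₁ D₂ t, IsMarkovKernel (U D₁ D₂ t)] (𝓑 : RelDB X₁ X₂ n₁ n₂) :
    IsMarkovKernel (buildRelations c U ρ 𝓑) :=
  ⟨fun D => Measure.isProbabilityMeasure_map (μ := stateLaw c U ρ 𝓑 D.1 D.2 c.T) (by fun_prop)⟩

/-- This form, selection followed by noisy answers to the selected queries, is the one to which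
`ZCDP.comp` applies. -/
lemma accessKernel_apply (𝓑 : RelDB X₁ X₂ n₁ n₂) (D₁ : Table X₁ s₁) (D₂ : Table X₂ s₂)
    (s : State X₁ X₂ k s₁ s₂) :
    accessKernel c ρ 𝓑 D₁ D₂ s = (Kernel.ofFunOfCountable fun O =>
      (Measure.pi fun _ : Query X₁ X₂ k => gaussianReal 0 1).map
        fun z => observe 𝓑 (noiseScale c ρ 𝓑.B.count) ((s, O), z)) ∘ₘ
      selectKernel c ρ 𝓑 D₁ D₂ s := by
  have hobs := measurable_observe (k := k) (s₁ := s₁) (s₂ := s₂) 𝓑 (noiseScale c ρ 𝓑.B.count)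
  refine Measure.ext_of_lintegral _ fun f hf => ?_
  rw [Measure.lintegral_bind (Kernel.aemeasurable _) hf.aemeasurable, accessKernel,
    Kernel.lintegral_comp _ _ _ hf]
  simp only [Kernel.lintegral_deterministic' _ hf]
  have hfo : Measurable fun p => f (observe (k := k) (s₁ := s₁) (s₂ := s₂) 𝓑
    (noiseScale c ρ 𝓑.B.count) p) := hf.comp hobs
  rw [Kernel.lintegral_prod _ _ _ hfo]
  simp only [Kernel.const_apply]
  have hG := hfo.lintegral_prod_right' (ν := Measure.pi fun _ : Query X₁ X₂ k => gaussianReal 0 1)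
  rw [Kernel.lintegral_prod _ _ _ hG, Kernel.lintegral_id' hG.lintegral_prod_right']
  exact lintegral_congr fun O => (lintegral_map hf (hobs.comp measurable_prodMk_left)).symm

lemma card_le_ae_selectKernel (𝓑 : RelDB X₁ X₂ n₁ n₂) (D₁ : Table X₁ s₁) (D₂ : Table X₂ s₂)
    (s : State X₁ X₂ k s₁ s₂) : ∀ᵐ O ∂selectKernel c ρ 𝓑 D₁ D₂ s, O.card ≤ c.K := by
  rw [ae_iff_of_countable]
  intro O hO
  change (selectWorkloads c ρ 𝓑 ⟨D₁, D₂, s.1⟩ s.2.1).toMeasure {O} ≠ 0 at hO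
  rw [PMF.toMeasure_apply_singleton _ _ (measurableSet_singleton O), ← PMF.mem_support_iff,
    selectWorkloads, PMF.mem_support_bind_iff] at hO
  obtain ⟨P, -, hP⟩ := hO
  exact card_le_of_mem_support_expSelect _ _ _ hP

variable {c ρ} {m : ℕ} {𝓑 𝓑' : RelDB X₁ X₂ n₁ n₂}

lemma ZCDP.selectKernel (hm : 0 < m) (h : 𝓑 ∈ BoundedDB X₁ X₂ n₁ n₂ c.dmax m)
    (h' : 𝓑' ∈ BoundedDB X₁ X₂ n₁ n₂ c.dmax m) (hadj : Adjacent 𝓑 𝓑') (hα : 0 ≤ c.α)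
    (D₁ : Table X₁ s₁) (D₂ : Table X₂ s₂) (s : State X₁ X₂ k s₁ s₂) :
    ZCDP (c.K * (c.α * c.ε₀ ρ ^ 2 / 2)) (RelSynth.selectKernel c ρ 𝓑 D₁ D₂ s)
      (RelSynth.selectKernel c ρ 𝓑' D₁ D₂ s) := by
  change ZCDP _ (selectWorkloads c ρ 𝓑 ⟨D₁, D₂, s.1⟩ s.2.1).toMeasure
    (selectWorkloads c ρ 𝓑' ⟨D₁, D₂, s.1⟩ s.2.1).toMeasure
  let _ : MeasurableSpace (Workload d₁ d₂ k) := ⊤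
  have : DiscreteMeasurableSpace (Workload d₁ d₂ k) := ⟨fun _ => trivial⟩
  have hd : 0 < c.dmax := pos_of_mem_boundedDB hm h
  have hε : 0 ≤ c.ε₀ ρ := Real.sqrt_nonneg _
  have hm' : (0 : ℝ) < m := by exact_mod_cast hm
  have hd' : (0 : ℝ) < c.dmax := by exact_mod_cast hd
  -- The subsample has the same law for both databases and costs nothing; the factor `m / dmax`
  -- makes the sensitivity of the score equal to one.
  refine (ZCDP.pmf_bind (ρ' := c.K * ((√c.α * c.ε₀ ρ) ^ 2 / 2)) ZCDP.rfl fun P _ =>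
    ZCDP.expSelect (fun w => ?_) _ _).mono (le_of_eq ?_)
  · rw [h.1, h'.1, ← mul_sub, abs_mul, abs_of_nonneg (by positivity)]
    calc _ ≤ √c.α * c.ε₀ ρ * (m / c.dmax) * (c.dmax / m) := by
          gcongr
          exact abs_score_sub_score_le h h' hadj _ w
      _ = _ := by field_simp
  · rw [mul_pow, Real.sq_sqrt hα, zero_add]

lemma ZCDP.accessKernel (hm : 0 < m) (h : 𝓑 ∈ BoundedDB X₁ X₂ n₁ n₂ c.dmax m)
    (h' : 𝓑' ∈ BoundedDB X₁ X₂ n₁ n₂ c.dmax m) (hadj : Adjacent 𝓑 𝓑') (hα : 0 ≤ c.α)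
    (hα₁ : c.α < 1) (hρ : 0 < ρ) (hT : 0 < c.T)
    (D₁ : Table X₁ s₁) (D₂ : Table X₂ s₂) (s : State X₁ X₂ k s₁ s₂) :
    ZCDP (c.K * (c.ε₀ ρ ^ 2 / 2)) (RelSynth.accessKernel c ρ 𝓑 D₁ D₂ s)
      (RelSynth.accessKernel c ρ 𝓑' D₁ D₂ s) := by
  rw [accessKernel_apply, accessKernel_apply, h.1, h'.1]
  have hd : 0 < c.dmax := pos_of_mem_boundedDB hm h
  have hm' : (0 : ℝ) < m := by exact_mod_cast hm
  have hd' : (0 : ℝ) < c.dmax := by exact_mod_cast hd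
  have hT' : (0 : ℝ) < c.T := by exact_mod_cast hT
  have hα' : 0 < 1 - c.α := by linarith
  have hε : 0 < c.K → 0 < c.ε₀ ρ := fun hK => by
    have hK' : (0 : ℝ) < c.K := by exact_mod_cast hK
    exact Real.sqrt_pos.2 (by positivity)
  refine ((ZCDP.selectKernel hm h h' hadj hα D₁ D₂ s).comp
    (ρ' := c.K * ((1 - c.α) * c.ε₀ ρ ^ 2 / 2)) ?_).mono (le_of_eq (by ring))
  filter_upwards [card_le_ae_selectKernel c ρ 𝓑 D₁ D₂ s] with O hO
  refine (ZCDP.observe h h' hadj s fun hne => ?_).mono ?_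
  · have := hε (hne.card_pos.trans_le hO)
    unfold noiseScale
    positivity
  -- For `K = 0` division by zero gives `ε₀ = 0` and noise scale `0`, but then no query is answered.
  · rcases Nat.eq_zero_or_pos c.K with hK | hK
    · rw [hK] at hO ⊢
      simp [Nat.le_zero.1 hO]
    · have := hε hK
      have hO' : (O.card : ℝ) ≤ c.K := by exact_mod_cast hO
      have heq : ((c.dmax : ℝ) / m / noiseScale c ρ m) ^ 2 = (1 - c.α) * c.ε₀ ρ ^ 2 / 2 := by
        unfold noiseScale
        rw [div_div_eq_mul_div]
        have hs := Real.sq_sqrt hα'.le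
        have h2 := Real.sq_sqrt (zero_le_two : (0 : ℝ) ≤ 2)
        have : (c.dmax : ℝ) / m * (m * √(1 - c.α) * c.ε₀ ρ) / (√2 * c.dmax) =
            √(1 - c.α) * c.ε₀ ρ / √2 := by
          field_simp
        rw [this, div_pow, mul_pow, hs, h2]
      rw [heq]
      gcongr

lemma ZCDP.stateLaw [∀ D₁ D₂ t, IsMarkovKernel (U D₁ D₂ t)] (hm : 0 < m)
    (h : 𝓑 ∈ BoundedDB X₁ X₂ n₁ n₂ c.dmax m) (h' : 𝓑' ∈ BoundedDB X₁ X₂ n₁ n₂ c.dmax m)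
    (hadj : Adjacent 𝓑 𝓑') (hα : 0 ≤ c.α) (hα₁ : c.α < 1) (hρ : 0 < ρ) (hT : 0 < c.T)
    (D₁ : Table X₁ s₁) (D₂ : Table X₂ s₂) (t : ℕ) :
    ZCDP (t * (c.K * (c.ε₀ ρ ^ 2 / 2))) (RelSynth.stateLaw c U ρ 𝓑 D₁ D₂ t)
      (RelSynth.stateLaw c U ρ 𝓑' D₁ D₂ t) := by
  induction t with
  | zero =>
    have : IsProbabilityMeasure (RelSynth.stateLaw c U ρ 𝓑 D₁ D₂ 0) := inferInstance
    simp only [Nat.cast_zero, zero_mul, RelSynth.stateLaw] at this ⊢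
    exact ZCDP.rfl
  | succ t ih =>
    simp only [RelSynth.stateLaw]
    refine (ih.comp (ρ' := c.K * (c.ε₀ ρ ^ 2 / 2)) (Filter.Eventually.of_forall fun s => ?_)).mono
      (le_of_eq (by push_cast; ring))
    simp only [stepKernel, Kernel.comp_apply]
    -- The update is the same kernel for both databases, hence composes at cost zero.
    refine ((ZCDP.accessKernel hm h h' hadj hα hα₁ hρ hT D₁ D₂ s).comp
      (Filter.Eventually.of_forall fun s => ZCDP.rfl)).mono (by rw [add_zero])

lemma ZCDP.buildRelations [∀ D₁ D₂ t, IsMarkovKernel (U D₁ D₂ t)] (hm : 0 < m)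
    (h : 𝓑 ∈ BoundedDB X₁ X₂ n₁ n₂ c.dmax m) (h' : 𝓑' ∈ BoundedDB X₁ X₂ n₁ n₂ c.dmax m)
    (hadj : Adjacent 𝓑 𝓑') (hα : 0 ≤ c.α) (hα₁ : c.α < 1) (hρ : 0 < ρ)
    (D : Table X₁ s₁ × Table X₂ s₂) :
    ZCDP ρ (RelSynth.buildRelations c U ρ 𝓑 D) (RelSynth.buildRelations c U ρ 𝓑' D) := by
  refine ZCDP.map (g := Prod.fst) ?_ measurable_fst
  -- Without iterations only the initialization remains, which depends on the synthetic tables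
  -- alone.
  rcases Nat.eq_zero_or_pos c.T with hT | hT
  · rw [hT]
    exact ZCDP.rfl.mono (μ := RelSynth.stateLaw c U ρ 𝓑 D.1 D.2 0) hρ.le
  · refine (ZCDP.stateLaw U hm h h' hadj hα hα₁ hρ hT D.1 D.2 c.T).mono ?_
    rw [Config.ε₀, Real.sq_sqrt (by positivity)]
    rcases Nat.eq_zero_or_pos c.K with hK | hK
    · simp [hK, hρ.le]
    · have hK' : (0 : ℝ) < c.K := by exact_mod_cast hK
      have hT' : (0 : ℝ) < c.T := by exact_mod_cast hT
      refine le_of_eq ?_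
      field_simp

/-! ### The whole mechanism -/

lemma synthesize_apply {M₁ : RelDB X₁ X₂ n₁ n₂ → Measure (Table X₁ s₁)}
    {M₂ : RelDB X₁ X₂ n₁ n₂ → Measure (Table X₂ s₂)} [∀ 𝓑, IsProbabilityMeasure (M₁ 𝓑)]
    [∀ 𝓑, IsProbabilityMeasure (M₂ 𝓑)] [∀ D₁ D₂ t, IsMarkovKernel (U D₁ D₂ t)]
    (𝓑 : RelDB X₁ X₂ n₁ n₂) (O : Set (RelDB X₁ X₂ s₁ s₂)) :
    synthesize M₁ M₂ c U ρ 𝓑 O = ∫⁻ D₁, ∫⁻ D₂, buildRelations c U ρ 𝓑 (D₁, D₂)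
      {B | (⟨D₁, D₂, B⟩ : RelDB X₁ X₂ s₁ s₂) ∈ O} ∂M₂ 𝓑 ∂M₁ 𝓑 := by
  have hO : MeasurableSet O := MeasurableSpace.measurableSet_top
  rw [synthesize, Measure.map_apply Measurable.of_discrete hO,
    Measure.compProd_apply MeasurableSet.of_discrete,
    lintegral_prod _ Measurable.of_discrete.aemeasurable]
  rfl

/-- Approximate privacy is applied from the innermost integral outwards. Truncating each
intermediate bound at `1` keeps it a test function for `lintegral_le_of_measure_le`, and splitting
off each `δ` before the next step keeps it from being multiplied by some `e^ε`. -/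
lemma IsDP.synthesize {Dom : Set (RelDB X₁ X₂ n₁ n₂)}
    {M₁ : RelDB X₁ X₂ n₁ n₂ → Measure (Table X₁ s₁)}
    {M₂ : RelDB X₁ X₂ n₁ n₂ → Measure (Table X₂ s₂)} [∀ 𝓑, IsProbabilityMeasure (M₁ 𝓑)]
    [∀ 𝓑, IsProbabilityMeasure (M₂ 𝓑)] [∀ D₁ D₂ t, IsMarkovKernel (U D₁ D₂ t)]
    {ε₁ δ₁ ε₂ δ₂ ε δ : ℝ} (hδ₁ : 0 ≤ δ₁) (hδ₂ : 0 ≤ δ₂) (hδ : 0 ≤ δ)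
    (hM₁ : IsDP Dom M₁ ε₁ δ₁) (hM₂ : IsDP Dom M₂ ε₂ δ₂)
    (hU : ∀ D, IsDP Dom (fun 𝓑 => buildRelations c U ρ 𝓑 D) ε δ) :
    IsDP Dom (RelSynth.synthesize M₁ M₂ c U ρ) (ε₁ + ε₂ + ε) (δ₁ + δ₂ + δ) := by
  intro 𝓑 h 𝓑' h' hadj O _
  rw [synthesize_apply, synthesize_apply]
  let g' : Table X₁ s₁ → Table X₂ s₂ → ℝ≥0∞ := fun D₁ D₂ => buildRelations c U ρ 𝓑' (D₁, D₂)
      {B | (⟨D₁, D₂, B⟩ : RelDB X₁ X₂ s₁ s₂) ∈ O}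
  let E : ℝ → ℝ≥0∞ := fun ε => ENNReal.ofReal (Real.exp ε)
  let f₂ : Table X₁ s₁ → Table X₂ s₂ → ℝ≥0∞ := fun D₁ D₂ => min 1 (E ε * g' D₁ D₂)
  let f₁ : Table X₁ s₁ → ℝ≥0∞ := fun D₁ => min 1 (E ε₂ * ∫⁻ D₂, f₂ D₁ D₂ ∂M₂ 𝓑')
  have hmin : ∀ {a b d : ℝ≥0∞}, a ≤ 1 → a ≤ b + d → a ≤ min 1 b + d := fun {a b d} h1 h2 => by
    rcases min_choice 1 b with h | h <;> rw [h]
    · exact h1.trans le_self_add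
    · exact h2
  have hint : ∀ D₁, ∫⁻ D₂, f₂ D₁ D₂ ∂M₂ 𝓑 ≤ f₁ D₁ + ENNReal.ofReal δ₂ := fun D₁ => by
    refine hmin ?_ (lintegral_le_of_measure_le (hM₂ 𝓑 h 𝓑' h' hadj) Measurable.of_discrete
      fun D₂ => min_le_left _ _)
    calc ∫⁻ D₂, f₂ D₁ D₂ ∂M₂ 𝓑 ≤ ∫⁻ _, 1 ∂M₂ 𝓑 := lintegral_mono fun _ => min_le_left _ _
      _ = 1 := by simp
  calc ∫⁻ D₁, ∫⁻ D₂, buildRelations c U ρ 𝓑 (D₁, D₂)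
        {B | (⟨D₁, D₂, B⟩ : RelDB X₁ X₂ s₁ s₂) ∈ O} ∂M₂ 𝓑 ∂M₁ 𝓑
      ≤ ∫⁻ D₁, ∫⁻ D₂, (f₂ D₁ D₂ + ENNReal.ofReal δ) ∂M₂ 𝓑 ∂M₁ 𝓑 :=
        lintegral_mono fun D₁ => lintegral_mono fun D₂ =>
          hmin prob_le_one (hU (D₁, D₂) 𝓑 h 𝓑' h' hadj _ trivial)
    _ = ∫⁻ D₁, ∫⁻ D₂, f₂ D₁ D₂ ∂M₂ 𝓑 ∂M₁ 𝓑 + ENNReal.ofReal δ := by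
        simp [lintegral_add_right]
    _ ≤ ∫⁻ D₁, (f₁ D₁ + ENNReal.ofReal δ₂) ∂M₁ 𝓑 + ENNReal.ofReal δ := by
        gcongr with D₁
        exact hint D₁
    _ = ∫⁻ D₁, f₁ D₁ ∂M₁ 𝓑 + ENNReal.ofReal δ₂ + ENNReal.ofReal δ := by
        simp [lintegral_add_right]
    _ ≤ E ε₁ * ∫⁻ D₁, f₁ D₁ ∂M₁ 𝓑' + ENNReal.ofReal δ₁ + ENNReal.ofReal δ₂ +
          ENNReal.ofReal δ := by
        gcongr
        exact lintegral_le_of_measure_le (hM₁ 𝓑 h 𝓑' h' hadj) Measurable.of_discrete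
          fun D₁ => min_le_left _ _
    _ ≤ E ε₁ * ∫⁻ D₁, E ε₂ * ∫⁻ D₂, E ε * g' D₁ D₂ ∂M₂ 𝓑' ∂M₁ 𝓑' + ENNReal.ofReal δ₁ +
          ENNReal.ofReal δ₂ + ENNReal.ofReal δ := by
        gcongr with D₁
        refine (min_le_right _ _).trans ?_
        gcongr with D₂
        exact min_le_right _ _
    _ = _ := by
        simp only [lintegral_const_mul' _ _ ENNReal.ofReal_ne_top, E]
        rw [← mul_assoc, ← mul_assoc, ofReal_exp_mul_ofReal_exp, ofReal_exp_mul_ofReal_exp,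
          ENNReal.ofReal_add (by positivity) hδ, ENNReal.ofReal_add hδ₁ hδ₂]
        simp only [add_assoc]
        rfl

instance (s₁ s₂ m : ℕ) : IsMarkovKernel (unbiasedSampling s₁ s₂ m) :=
  ⟨fun b => PMF.toMeasure.isProbabilityMeasure
    ((ubs m (s₁ * s₂) m (flatten b)).map (reshape s₁ s₂))⟩

/-! ### Arithmetic of the budget -/

lemma rhoOf_pos {ε δ : ℝ} (hε : 0 < ε) (hδ : 0 < δ) (hδ1 : δ ≤ 1) : 0 < rhoOf ε δ := by
  have hL : 0 ≤ Real.log (1 / δ) := Real.log_nonneg (by rwa [le_div_iff₀ hδ, one_mul])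
  have := Real.sqrt_lt_sqrt hL (lt_add_of_pos_right (Real.log (1 / δ)) hε)
  exact pow_pos (sub_pos.2 this) 2

/-- Completing the square with `L = log (1/δ)`, the equation reads `(√ρ + √L)² = L + ε`, which is
how `rhoOf` is defined. -/
lemma rhoOf_add {ε δ : ℝ} (hε : 0 < ε) (hδ : 0 < δ) (hδ1 : δ ≤ 1) :
    rhoOf ε δ + 2 * √(rhoOf ε δ * Real.log (1 / δ)) = ε := by
  have hL : 0 ≤ Real.log (1 / δ) := Real.log_nonneg (by rwa [le_div_iff₀ hδ, one_mul])
  have hlt := Real.sqrt_lt_sqrt hL (lt_add_of_pos_right (Real.log (1 / δ)) hε)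
  have h1 := Real.sq_sqrt hL
  have h2 := Real.sq_sqrt (add_nonneg hL hε.le)
  rw [Real.sqrt_mul' _ hL, rhoOf, Real.sqrt_sq (sub_nonneg.2 hlt.le)]
  linear_combination h2 - h1

end

end RelSynth

theorem theorem1 {d₁ d₂ : ℕ} {X₁ : Fin d₁ → Type*} {X₂ : Fin d₂ → Type*}
    [∀ j, Fintype (X₁ j)] [∀ j, Fintype (X₂ j)] {k n₁ n₂ s₁ s₂ : ℕ}
    -- the original database has `m` relationships and degrees at most `c.dmax`
    (m : ℕ) (hm : 0 < m)
    (c : Config X₁ X₂ k s₁ s₂) (hα₀ : 0 ≤ c.α) (hα₁ : c.α < 1)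
    -- the mechanisms that generate the individual synthetic tables
    (M₁ : RelDB X₁ X₂ n₁ n₂ → Measure (Table X₁ s₁)) [∀ 𝓑, IsProbabilityMeasure (M₁ 𝓑)]
    (M₂ : RelDB X₁ X₂ n₁ n₂ → Measure (Table X₂ s₂)) [∀ 𝓑, IsProbabilityMeasure (M₂ 𝓑)]
    (ε₁ δ₁ ε₂ δ₂ : ℝ) (hε₁ : 0 ≤ ε₁) (hδ₁ : 0 ≤ δ₁) (hε₂ : 0 ≤ ε₂) (hδ₂ : 0 ≤ δ₂)
    (hM₁ : IsDP (BoundedDB X₁ X₂ n₁ n₂ c.dmax m) M₁ ε₁ δ₁)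
    (hM₂ : IsDP (BoundedDB X₁ X₂ n₁ n₂ c.dmax m) M₂ ε₂ δ₂) :
    -- relaxed optimization and unbiased sampling, with the budget `(εrel, δrel)`
    (∀ (S : Solver X₁ X₂ k s₁ s₂) (msyn : ℕ), (∀ D₁ D₂, IsMarkovKernel (S D₁ D₂)) →
      S.IsExact msyn → ∀ εrel δrel : ℝ, 0 < εrel → 0 < δrel → δrel ≤ 1 →
        IsDP (BoundedDB X₁ X₂ n₁ n₂ c.dmax m)
          (synthesize M₁ M₂ c (relaxAndSample S msyn) (rhoOf εrel δrel))
          (ε₁ + ε₂ + εrel) (δ₁ + δ₂ + δrel)) ∧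
    -- any update rule without access to the original data, and any budget `ρ`
    (∀ U : UpdateRule X₁ X₂ k s₁ s₂, (∀ D₁ D₂ t, IsMarkovKernel (U D₁ D₂ t)) →
      ∀ ρ δrel : ℝ, 0 < ρ → 0 < δrel → δrel ≤ 1 →
        IsDP (BoundedDB X₁ X₂ n₁ n₂ c.dmax m) (synthesize M₁ M₂ c U ρ)
          (ε₁ + ε₂ + (ρ + 2 * √(ρ * Real.log (1 / δrel)))) (δ₁ + δ₂ + δrel)) := by
  have main : ∀ U : UpdateRule X₁ X₂ k s₁ s₂, (∀ D₁ D₂ t, IsMarkovKernel (U D₁ D₂ t)) →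
      ∀ ρ δrel : ℝ, 0 < ρ → 0 < δrel → δrel ≤ 1 →
        IsDP (BoundedDB X₁ X₂ n₁ n₂ c.dmax m) (synthesize M₁ M₂ c U ρ)
          (ε₁ + ε₂ + (ρ + 2 * √(ρ * Real.log (1 / δrel)))) (δ₁ + δ₂ + δrel) :=
    fun U _ ρ δrel hρ hδ hδ' => IsDP.synthesize U hδ₁ hδ₂ hδ.le hM₁ hM₂
      fun D _ h _ h' hadj _ hO =>
        (ZCDP.buildRelations U hm h h' hadj hα₀ hα₁ hρ D).measure_le hρ hδ hδ' hO
  refine ⟨fun S msyn hS _ εrel δrel hε hδ hδ' => ?_, main⟩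
  -- Relaxed optimization followed by sampling is one of the update rules covered by `main`.
  have hU : ∀ D₁ D₂ t, IsMarkovKernel (relaxAndSample S msyn D₁ D₂ t) := fun D₁ D₂ t => by
    unfold relaxAndSample
    infer_instance
  have := main (relaxAndSample S msyn) hU _ δrel (rhoOf_pos hε hδ hδ') hδ hδ'
  rwa [rhoOf_add hε hδ hδ'] at this
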